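/- **Setting.** A *graded domain* is a $\mathbb Z\times\mathbb Z$-graded commutative integral domain $R$ such that the two degrees $(\mathrm{gr}_1,\mathrm{gr}_2)$ of every nonzero homogeneous element have the same parity, and such that either all these degrees are even or $-1=1$ in $R$. It is a *graded valuation ring* if, of any two homogeneous elements, one divides the other, and it is *type-zero* if its degree-$(0,0)$ piece consists exactly of $0$ and the units of $R$. Let $R_U$ and $R_V$ be type-zero graded valuation rings with surjective graded ring homomorphisms $f\colon R_U\to\mathbb K$ and $g\colon R_V\to\mathbb K$ to a common field $\mathbb K$ concentrated in degree $(0,0)$. The *grid ring* is the bigraded ring $S=\{(r,s)\in R_U\times R_V: f(r)=g(s)\}$; put $\mathfrak m_U=\{(\mu,0)\in S\}$ and $\mathfrak m_V=\{(0,\nu)\in S\}$. Both $R_U$ and $R_V$ are $S$-algebras via the projections. An *$S$-complex* is a finitely generated free $\mathbb Z\times\mathbb Z$-graded $S$-module $C$ whose nonzero homogeneous elements have $\mathrm{gr}_1\equiv\mathrm{gr}_2 \pmod 2$, with an $S$-linear differential $\partial$ of degree $(-1,-1)$, $\partial^2=0$. It is *left knotlike* if $H_*(C\otimes_S R_U)/R_U\text{-torsion}\cong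 R_U$ by an $R_U$-linear isomorphism that preserves $\mathrm{gr}_2$ and shifts $\mathrm{gr}_1$ by a constant, and *right knotlike* if $H_*(C\otimes_S R_V)/R_V\text{-torsion}\cong R_V$ by an $R_V$-linear isomorphism that preserves $\mathrm{gr}_1$ and shifts $\mathrm{gr}_2$ by a constant. A *knotlike complex* is an $S$-complex that is left knotlike, right knotlike and reduced, i.e. $\partial C\subseteq(\mathfrak m_U,\mathfrak m_V)C$. A *(right) local map* $C_1\to C_2$ is an $S$-linear chain map that preserves $\mathrm{gr}_1$, shifts $\mathrm{gr}_2$ by a constant, and induces an isomorphism on $H_*(-\otimes_S R_V)/R_V\text{-torsion}$. Two knotlike complexes are *(right) locally equivalent* if there are local maps between them in both directions. The tensor product $C_1\otimes_S C_2$ has differential $\partial(a\otimes b)=\partial a\otimes b+(-1)^{|a|}a\otimes\partial b$, and the dual $C^\vee=\mathrm{Hom}_S(C,S)$ has differential $\partial^\vee\varphi=-(-1)^{|\varphi|}\varphi\circ\partial$, where $|\cdot|$ is either degree mod $2$. The trivial complex is $S$ with zero differential. **Proposition.** The tensor product of two knotlike complexes is knotlike, and the tensor product of two local maps between knotlike complexes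 is a local map. The dual of a knotlike complex is knotlike, and the dual of a local map between knotlike complexes is a local map. The trivial complex $S$ is knotlike. The set of (right) local equivalence classes of knotlike complexes over $S$ is an abelian group under the operation $[C_1]\cdot[C_2]=[C_1\otimes_S C_2]$, with identity $[S]$ and inverses $[C]^{-1}=[C^\vee]$; in particular, $C\otimes_S C^\vee$ is locally equivalent to $S$. -/

import Mathlib

open scoped TensorProduct DirectSum

universe u

noncomputable section

/-! ## Graded valuation rings and grid rings -/

/-- The conditions that make a `ℤ × ℤ`-graded commutative ring a graded domain: it is an integral
domain, the two degrees of a nonzero homogeneous element have the same parity, and either all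
these degrees are even or `-1 = 1`. -/
structure IsGradedDomain {R : Type u} [CommRing R] (𝒜 : ℤ × ℤ → AddSubgroup R)
    [GradedRing 𝒜] : Prop where
  isDomain : IsDomain R
  parity : ∀ d : ℤ × ℤ, ∀ x ∈ 𝒜 d, x ≠ 0 → d.1 ≡ d.2 [ZMOD 2]
  even_or_neg_one : (∀ d : ℤ × ℤ, ∀ x ∈ 𝒜 d, x ≠ 0 → Even d.1 ∧ Even d.2) ∨ (-1 : R) = 1

/-- A graded valuation ring: a graded domain in which the homogeneous elements are totally ordered
by divisibility. -/
structure IsGradedValuationRing {R : Type u} [CommRing R] (𝒜 : ℤ × ℤ → AddSubgroup R)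
    [GradedRing 𝒜] : Prop extends IsGradedDomain 𝒜 where
  dvd_total : ∀ x y : R, SetLike.IsHomogeneousElem 𝒜 x → SetLike.IsHomogeneousElem 𝒜 y →
    x ∣ y ∨ y ∣ x

/-- A type-zero graded valuation ring: the degree-`(0,0)` piece consists precisely of zero and the
invertible elements. -/
structure IsTypeZero {R : Type u} [CommRing R] (𝒜 : ℤ × ℤ → AddSubgroup R)
    [GradedRing 𝒜] : Prop extends IsGradedValuationRing 𝒜 where
  mem_zero_iff : ∀ x : R, x ∈ 𝒜 0 ↔ x = 0 ∨ IsUnit x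

/-- The input for a grid ring: two type-zero graded valuation rings `RU` and `RV`, a field `K`, and
bigraded quotient maps `f : RU → K` and `g : RV → K`, where `K` is concentrated in
degree `(0,0)`. -/
structure GridData where
  RU : Type u
  RV : Type u
  K : Type u
  [commRingU : CommRing RU]
  [commRingV : CommRing RV]
  [fieldK : Field K]
  grU : ℤ × ℤ → AddSubgroup RU
  grV : ℤ × ℤ → AddSubgroup RV
  [gradedU : GradedRing grU]
  [gradedV : GradedRing grV]
  typeZeroU : IsTypeZero grU
  typeZeroV : IsTypeZero grV
  f : RU →+* K
  g : RV →+* K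
  f_surjective : Function.Surjective f
  g_surjective : Function.Surjective g
  f_graded : ∀ d : ℤ × ℤ, d ≠ 0 → ∀ x ∈ grU d, f x = 0
  g_graded : ∀ d : ℤ × ℤ, d ≠ 0 → ∀ x ∈ grV d, g x = 0

attribute [instance] GridData.commRingU GridData.commRingV GridData.fieldK
  GridData.gradedU GridData.gradedV

namespace GridData

variable (G : GridData.{u})

/-- The grid ring `{(r, s) | f r = g s} ⊆ RU × RV`. -/
def S : Type u :=
  ((G.f.comp (RingHom.fst G.RU G.RV)).eqLocus (G.g.comp (RingHom.snd G.RU G.RV)) :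
    Subring (G.RU × G.RV))

instance : CommRing G.S :=
  inferInstanceAs (CommRing
    ((G.f.comp (RingHom.fst G.RU G.RV)).eqLocus (G.g.comp (RingHom.snd G.RU G.RV)) :
      Subring (G.RU × G.RV)))

/-- The projection of the grid ring to `RU`. -/
def pU : G.S →+* G.RU := (RingHom.fst G.RU G.RV).comp (Subring.subtype _)

/-- The projection of the grid ring to `RV`. -/
def pV : G.S →+* G.RV := (RingHom.snd G.RU G.RV).comp (Subring.subtype _)

theorem S_ext {x y : G.S} (hU : G.pU x = G.pU y) (hV : G.pV x = G.pV y) : x = y :=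
  Subtype.ext (Prod.ext hU hV)

theorem f_pU (x : G.S) : G.f (G.pU x) = G.g (G.pV x) := x.2

/-- The element `(a, b)` of the grid ring. -/
def pair (a : G.RU) (b : G.RV) (h : G.f a = G.g b) : G.S := ⟨(a, b), h⟩

@[simp] theorem pU_pair (a : G.RU) (b : G.RV) (h : G.f a = G.g b) : G.pU (G.pair a b h) = a := rfl

@[simp] theorem pV_pair (a : G.RU) (b : G.RV) (h : G.f a = G.g b) : G.pV (G.pair a b h) = b := rfl

instance : Algebra G.S G.RU := G.pU.toAlgebra

instance : Algebra G.S G.RV := G.pV.toAlgebra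

/-- The ideal `𝔪_U = {(μ, 0)}` of the grid ring. -/
def mU : Ideal G.S := RingHom.ker G.pV

/-- The ideal `𝔪_V = {(0, ν)}` of the grid ring. -/
def mV : Ideal G.S := RingHom.ker G.pU

/-- The grading of the grid ring: `(r, s)` has degree `d` if both `r` and `s` do. -/
def gr (d : ℤ × ℤ) : AddSubgroup G.S :=
  (G.grU d).comap G.pU.toAddMonoidHom ⊓ (G.grV d).comap G.pV.toAddMonoidHom

theorem mem_gr {d : ℤ × ℤ} {x : G.S} : x ∈ G.gr d ↔ G.pU x ∈ G.grU d ∧ G.pV x ∈ G.grV d :=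
  Iff.rfl

theorem f_component (a : G.RU) (d : ℤ × ℤ) :
    G.f (DirectSum.decompose G.grU a d) = if d = 0 then G.f a else 0 := by
  split_ifs with hd
  · subst hd
    induction a using DirectSum.Decomposition.inductionOn G.grU with
    | zero => simp
    | @homogeneous i m =>
      by_cases hi : i = 0
      · subst hi; simp
      · rw [DirectSum.decompose_of_mem_ne G.grU m.2 hi, G.f_graded i hi _ m.2, map_zero]
    | add m n hm hn => simp [DirectSum.decompose_add, hm, hn]
  · exact G.f_graded d hd _ (SetLike.coe_mem _)

theorem g_component (a : G.RV) (d : ℤ × ℤ) :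
    G.g (DirectSum.decompose G.grV a d) = if d = 0 then G.g a else 0 := by
  split_ifs with hd
  · subst hd
    induction a using DirectSum.Decomposition.inductionOn G.grV with
    | zero => simp
    | @homogeneous i m =>
      by_cases hi : i = 0
      · subst hi; simp
      · rw [DirectSum.decompose_of_mem_ne G.grV m.2 hi, G.g_graded i hi _ m.2, map_zero]
    | add m n hm hn => simp [DirectSum.decompose_add, hm, hn]
  · exact G.g_graded d hd _ (SetLike.coe_mem _)

/-- The degree-`d` component of an element of the grid ring. -/
def component (d : ℤ × ℤ) (x : G.S) : G.gr d :=
  ⟨G.pair (DirectSum.decompose G.grU (G.pU x) d) (DirectSum.decompose G.grV (G.pV x) d)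
    (by rw [f_component, g_component, f_pU]),
    G.mem_gr.2 ⟨(DirectSum.decompose G.grU (G.pU x) d).2, (DirectSum.decompose G.grV (G.pV x) d).2⟩⟩

theorem decompose_pU (y : ⨁ d, G.gr d) (d : ℤ × ℤ) :
    (DirectSum.decompose G.grU (G.pU (DirectSum.coeAddMonoidHom G.gr y)) d : G.RU)
      = G.pU (y d : G.S) := by
  induction y using DirectSum.induction_on with
  | zero => simp
  | of i x =>
    by_cases h : i = d
    · subst h
      simp [DirectSum.decompose_of_mem_same G.grU (G.mem_gr.1 x.2).1]
    · rw [DirectSum.of_eq_of_ne (β := fun d => G.gr d) i d x (Ne.symm h)]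
      simp [DirectSum.decompose_of_mem_ne G.grU (G.mem_gr.1 x.2).1 h]
  | add x y hx hy => simp [DirectSum.decompose_add, hx, hy]

theorem decompose_pV (y : ⨁ d, G.gr d) (d : ℤ × ℤ) :
    (DirectSum.decompose G.grV (G.pV (DirectSum.coeAddMonoidHom G.gr y)) d : G.RV)
      = G.pV (y d : G.S) := by
  induction y using DirectSum.induction_on with
  | zero => simp
  | of i x =>
    by_cases h : i = d
    · subst h
      simp [DirectSum.decompose_of_mem_same G.grV (G.mem_gr.1 x.2).2]
    · rw [DirectSum.of_eq_of_ne (β := fun d => G.gr d) i d x (Ne.symm h)]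
      simp [DirectSum.decompose_of_mem_ne G.grV (G.mem_gr.1 x.2).2 h]
  | add x y hx hy => simp [DirectSum.decompose_add, hx, hy]

theorem component_coe (y : ⨁ d, G.gr d) (d : ℤ × ℤ) :
    G.component d (DirectSum.coeAddMonoidHom G.gr y) = y d :=
  Subtype.ext (G.S_ext (G.decompose_pU y d) (G.decompose_pV y d))

open Classical in
/-- The sum of the homogeneous components of an element of the grid ring. -/
def decomp (x : G.S) : ⨁ d, G.gr d :=
  ∑ d ∈ DFinsupp.support (DirectSum.decompose G.grU (G.pU x)) ∪
    DFinsupp.support (DirectSum.decompose G.grV (G.pV x)), DirectSum.of _ d (G.component d x)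

theorem coe_decomp (x : G.S) : DirectSum.coeAddMonoidHom G.gr (G.decomp x) = x := by
  classical
  apply G.S_ext
  · simp only [decomp, map_sum, DirectSum.coeAddMonoidHom_of]
    conv_rhs => rw [← DirectSum.sum_support_decompose G.grU (G.pU x)]
    refine (Finset.sum_subset Finset.subset_union_left fun d _ hd => ?_).symm
    simpa [component] using hd
  · simp only [decomp, map_sum, DirectSum.coeAddMonoidHom_of]
    conv_rhs => rw [← DirectSum.sum_support_decompose G.grV (G.pV x)]
    refine (Finset.sum_subset Finset.subset_union_right fun d _ hd => ?_).symm
    simpa [component] using hd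

instance : DirectSum.Decomposition G.gr where
  decompose' := G.decomp
  left_inv := G.coe_decomp
  right_inv y := by
    refine DFinsupp.ext fun d => ?_
    have h := G.component_coe (G.decomp (DirectSum.coeAddMonoidHom G.gr y)) d
    rw [coe_decomp, component_coe] at h
    exact h.symm

instance : GradedRing G.gr where
  one_mem := by
    rw [mem_gr, map_one, map_one]
    exact ⟨SetLike.GradedOne.one_mem, SetLike.GradedOne.one_mem⟩
  mul_mem i j x y hx hy := by
    rw [mem_gr] at hx hy ⊢
    rw [map_mul, map_mul]
    exact ⟨SetLike.GradedMul.mul_mem hx.1 hy.1, SetLike.GradedMul.mul_mem hx.2 hy.2⟩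

theorem parity {d : ℤ × ℤ} {x : G.S} (hx : x ∈ G.gr d) (h0 : x ≠ 0) : d.1 ≡ d.2 [ZMOD 2] := by
  by_cases hU : G.pU x = 0
  · by_cases hV : G.pV x = 0
    · exact absurd (G.S_ext (by simpa using hU) (by simpa using hV)) h0
    · exact G.typeZeroV.parity d _ hx.2 hV
  · exact G.typeZeroU.parity d _ hx.1 hU

/-- Signs in the grid ring: multiplication by a homogeneous element of degree `d` does not see the
sign `(-1) ^ d.1`. -/
theorem negOnePow_smul {d : ℤ × ℤ} {x : G.S} (hx : x ∈ G.gr d) :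
    (d.1.negOnePow : ℤ) • x = x := by
  have hU : (d.1.negOnePow : ℤ) • G.pU x = G.pU x := by
    rcases G.typeZeroU.even_or_neg_one with h | h
    · by_cases h0 : G.pU x = 0
      · simp [h0]
      · rw [Int.negOnePow_even _ (h d _ hx.1 h0).1]; simp
    · rcases Int.even_or_odd d.1 with hd | hd
      · rw [Int.negOnePow_even _ hd]; simp
      · rw [Int.negOnePow_odd _ hd]
        simpa using congrArg (· * G.pU x) h
  have hV : (d.1.negOnePow : ℤ) • G.pV x = G.pV x := by
    rcases G.typeZeroV.even_or_neg_one with h | h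
    · by_cases h0 : G.pV x = 0
      · simp [h0]
      · rw [Int.negOnePow_even _ (h d _ hx.2 h0).1]; simp
    · rcases Int.even_or_odd d.1 with hd | hd
      · rw [Int.negOnePow_even _ hd]; simp
      · rw [Int.negOnePow_odd _ hd]
        simpa using congrArg (· * G.pV x) h
  exact G.S_ext (by rw [map_zsmul, hU]) (by rw [map_zsmul, hV])

end GridData

/-! ## Homology modulo torsion -/

section Homology

variable {R : Type u} [CommRing R] {M N : Type u} [AddCommGroup M] [Module R M]
  [AddCommGroup N] [Module R N]

/-- The homology `ker d / im d` of a differential `d`. -/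
abbrev Homology (d : M →ₗ[R] M) : Type u :=
  LinearMap.ker d ⧸ (LinearMap.range d).submoduleOf (LinearMap.ker d)

/-- The homology of a differential, modulo its torsion submodule. -/
abbrev HomologyModTorsion (d : M →ₗ[R] M) : Type u :=
  Homology d ⧸ Submodule.torsion R (Homology d)

namespace HomologyModTorsion

/-- The class of a cycle in the homology modulo torsion. -/
def mk (d : M →ₗ[R] M) : LinearMap.ker d →ₗ[R] HomologyModTorsion d :=
  (Submodule.torsion R (Homology d)).mkQ ∘ₗ
    ((LinearMap.range d).submoduleOf (LinearMap.ker d)).mkQ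

theorem mk_surjective (d : M →ₗ[R] M) : Function.Surjective (mk d) :=
  (Submodule.mkQ_surjective _).comp (Submodule.mkQ_surjective _)

variable {d : M →ₗ[R] M} {d' : N →ₗ[R] N}

/-- The map on cycles induced by a map that commutes with the differentials. -/
def cyclesMap (f : M →ₗ[R] N) (hf : ∀ x, f (d x) = d' (f x)) :
    LinearMap.ker d →ₗ[R] LinearMap.ker d' :=
  f.restrict fun z hz => by
    rw [LinearMap.mem_ker] at hz ⊢
    rw [← hf, hz, map_zero]

/-- The map on homology induced by a map that commutes with the differentials. -/
def homologyMap (f : M →ₗ[R] N) (hf : ∀ x, f (d x) = d' (f x)) : Homology d →ₗ[R] Homology d' :=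
  Submodule.mapQ _ _ (cyclesMap f hf) fun z hz => by
    obtain ⟨w, hw⟩ := hz
    exact ⟨f w, by rw [← hf, hw]; rfl⟩

/-- The map on homology modulo torsion induced by a map that commutes with the differentials. -/
def map (f : M →ₗ[R] N) (hf : ∀ x, f (d x) = d' (f x)) :
    HomologyModTorsion d →ₗ[R] HomologyModTorsion d' :=
  Submodule.mapQ _ _ (homologyMap f hf) fun z hz => by
    obtain ⟨a, ha⟩ := hz
    exact ⟨a, by rw [Submonoid.smul_def, ← map_smul, ← Submonoid.smul_def, ha, map_zero]⟩

theorem map_mk (f : M →ₗ[R] N) (hf : ∀ x, f (d x) = d' (f x)) (z : LinearMap.ker d) :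
    map f hf (mk d z) = mk d' (cyclesMap f hf z) := rfl

end HomologyModTorsion

end Homology

/-! ## Graded modules over a grid ring -/

section GradedModule

variable {G : GridData.{u}} {M : Type u} [AddCommGroup M] [Module G.S M]

theorem decompose_smul_of_mem (gr : ℤ × ℤ → AddSubgroup M) [DirectSum.Decomposition gr]
    (hsmul : ∀ d e : ℤ × ℤ, ∀ s ∈ G.gr d, ∀ x ∈ gr e, s • x ∈ gr (d + e))
    (s : G.S) {e : ℤ × ℤ} {m : M} (hm : m ∈ gr e) (d : ℤ × ℤ) :
    (DirectSum.decompose gr (s • m) d : M) = (DirectSum.decompose G.gr s (d - e) : G.S) • m := by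
  induction s using DirectSum.Decomposition.inductionOn G.gr with
  | zero => simp
  | @homogeneous i s =>
    by_cases h : i = d - e
    · have h' : i + e = d := by rw [h]; abel
      rw [DirectSum.decompose_of_mem_same gr (h' ▸ hsmul i e s s.2 m hm), ← h,
        DirectSum.decompose_of_mem_same G.gr s.2]
    · have h' : i + e ≠ d := fun h' => h (by rw [← h']; abel)
      rw [DirectSum.decompose_of_mem_ne gr (hsmul i e s s.2 m hm) h',
        DirectSum.decompose_of_mem_ne G.gr s.2 h, zero_smul]
  | add s t hs ht => simp [add_smul, DirectSum.decompose_add, hs, ht]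

/-- In a graded module with a homogeneous basis, degrees are read off from the coordinates. -/
theorem mem_gr_iff_repr (gr : ℤ × ℤ → AddSubgroup M) [DirectSum.Decomposition gr]
    (hsmul : ∀ d e : ℤ × ℤ, ∀ s ∈ G.gr d, ∀ x ∈ gr e, s • x ∈ gr (d + e))
    {ι : Type} [Fintype ι] (b : Module.Basis ι G.S M) (δ : ι → ℤ × ℤ)
    (hb : ∀ i, b i ∈ gr (δ i)) (d : ℤ × ℤ) (x : M) :
    x ∈ gr d ↔ ∀ i, b.repr x i ∈ G.gr (d - δ i) := by
  constructor
  · intro hx i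
    have h : x = ∑ i, (DirectSum.decompose G.gr (b.repr x i) (d - δ i) : G.S) • b i := by
      conv_lhs => rw [← DirectSum.decompose_of_mem_same gr hx, ← b.sum_repr x]
      rw [DirectSum.decompose_sum, DFinsupp.finsetSum_apply, AddSubgroup.val_finsetSum]
      exact Finset.sum_congr rfl fun i _ => decompose_smul_of_mem gr hsmul _ (hb i) d
    rw [h, b.repr_sum_self]
    exact SetLike.coe_mem _
  · intro h
    rw [← b.sum_repr x]
    refine AddSubgroup.sum_mem _ fun i _ => ?_
    simpa using hsmul _ _ _ (h i) _ (hb i)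

/-- A family of subgroups that is described by the coordinates in a basis is a grading. -/
theorem isInternal_of_repr (gr : ℤ × ℤ → AddSubgroup M)
    {ι : Type} [Fintype ι] (b : Module.Basis ι G.S M) (δ : ι → ℤ × ℤ)
    (h : ∀ d x, x ∈ gr d ↔ ∀ i, b.repr x i ∈ G.gr (d - δ i)) : DirectSum.IsInternal gr := by
  constructor
  · intro y z hyz
    have key : ∀ (y : ⨁ d, gr d) (i : ι) (d : ℤ × ℤ),
        (DirectSum.decompose G.gr (b.repr (DirectSum.coeAddMonoidHom gr y) i) (d - δ i) : G.S)
          = b.repr (y d : M) i := by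
      intro y i d
      induction y using DirectSum.induction_on with
      | zero => simp
      | of e x =>
        by_cases he : e = d
        · subst he
          simp [DirectSum.decompose_of_mem_same G.gr ((h e x).1 x.2 i)]
        · rw [DirectSum.of_eq_of_ne (β := fun d => gr d) e d x (Ne.symm he)]
          have he' : e - δ i ≠ d - δ i := fun h' => he (sub_left_injective h')
          simp [DirectSum.decompose_of_mem_ne G.gr ((h e x).1 x.2 i) he']
      | add x y hx hy => simp [DirectSum.decompose_add, hx, hy]
    refine DFinsupp.ext fun d => Subtype.ext (b.ext_elem fun i => ?_)
    rw [← key y i d, ← key z i d, hyz]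
  · intro x
    rw [← AddMonoidHom.mem_range, ← b.sum_repr x]
    refine AddSubgroup.sum_mem _ fun i _ => ?_
    induction b.repr x i using DirectSum.Decomposition.inductionOn G.gr with
    | zero => rw [zero_smul]; exact AddSubgroup.zero_mem _
    | @homogeneous e s =>
      have hm : (s : G.S) • b i ∈ gr (e + δ i) := by
        classical
        refine (h _ _).2 fun j => ?_
        by_cases hj : i = j
        · subst hj; simp
        · simp [Finsupp.single_eq_of_ne (Ne.symm hj)]
      exact ⟨DirectSum.of (fun d => gr d) _ ⟨_, hm⟩, by simp⟩
    | add s t hs ht => rw [add_smul]; exact AddSubgroup.add_mem _ hs ht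

/-- The map that multiplies homogeneous elements `x` by the sign `(-1) ^ |x|`, where `|x|` is the
first degree of `x`. -/
def gradedSignHom (gr : ℤ × ℤ → AddSubgroup M) [DirectSum.Decomposition gr] : M →+ M :=
  (DirectSum.toAddMonoid fun d : ℤ × ℤ => (d.1.negOnePow : ℤ) • (gr d).subtype).comp
    (DirectSum.decomposeAddEquiv gr).toAddMonoidHom

theorem gradedSignHom_of_mem (gr : ℤ × ℤ → AddSubgroup M) [DirectSum.Decomposition gr]
    {d : ℤ × ℤ} {x : M} (hx : x ∈ gr d) : gradedSignHom gr x = (d.1.negOnePow : ℤ) • x := by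
  simp [gradedSignHom, DirectSum.decompose_of_mem gr hx]

/-- The sign map is linear over the grid ring. -/
def gradedSign (gr : ℤ × ℤ → AddSubgroup M) [DirectSum.Decomposition gr]
    (hsmul : ∀ d e : ℤ × ℤ, ∀ s ∈ G.gr d, ∀ x ∈ gr e, s • x ∈ gr (d + e)) : M →ₗ[G.S] M where
  toFun := gradedSignHom gr
  map_add' := map_add _
  map_smul' s x := by
    rw [RingHom.id_apply]
    induction x using DirectSum.Decomposition.inductionOn gr with
    | zero => simp
    | @homogeneous e x =>
      induction s using DirectSum.Decomposition.inductionOn G.gr with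
      | zero => simp
      | @homogeneous d s =>
        rw [gradedSignHom_of_mem gr (hsmul d e s s.2 x x.2), gradedSignHom_of_mem gr x.2, Prod.fst_add,
          Int.negOnePow_add, Units.val_mul, mul_comm, SemigroupAction.mul_smul, ← smul_assoc _ (s : G.S) (x : M),
          G.negOnePow_smul s.2, smul_comm]
      | add s t hs ht => simp only [add_smul, map_add, hs, ht]
    | add x y hx hy => simp only [smul_add, map_add, hx, hy]

theorem gradedSign_of_mem (gr : ℤ × ℤ → AddSubgroup M) [DirectSum.Decomposition gr]
    (hsmul : ∀ d e : ℤ × ℤ, ∀ s ∈ G.gr d, ∀ x ∈ gr e, s • x ∈ gr (d + e))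
    {d : ℤ × ℤ} {x : M} (hx : x ∈ gr d) : gradedSign gr hsmul x = (d.1.negOnePow : ℤ) • x :=
  gradedSignHom_of_mem gr hx

/-- Coordinates of sums of multiples of basis vectors. -/
theorem smul_mem_of_repr (gr : ℤ × ℤ → AddSubgroup M)
    {ι : Type} [Fintype ι] (b : Module.Basis ι G.S M) (δ : ι → ℤ × ℤ)
    (h : ∀ d x, x ∈ gr d ↔ ∀ i, b.repr x i ∈ G.gr (d - δ i))
    (d e : ℤ × ℤ) (s : G.S) (hs : s ∈ G.gr d) (x : M) (hx : x ∈ gr e) : s • x ∈ gr (d + e) := by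
  refine (h _ _).2 fun i => ?_
  rw [map_smul, Finsupp.smul_apply, smul_eq_mul, add_sub_assoc]
  exact SetLike.GradedMul.mul_mem hs ((h e x).1 hx i)

theorem basis_mem_of_repr (gr : ℤ × ℤ → AddSubgroup M)
    {ι : Type} [Fintype ι] (b : Module.Basis ι G.S M) (δ : ι → ℤ × ℤ)
    (h : ∀ d x, x ∈ gr d ↔ ∀ i, b.repr x i ∈ G.gr (d - δ i)) (i : ι) : b i ∈ gr (δ i) := by
  classical
  refine (h _ _).2 fun j => ?_
  rw [b.repr_self, Finsupp.single_apply]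
  split_ifs with hij
  · subst hij; rw [sub_self]; exact SetLike.GradedOne.one_mem
  · exact AddSubgroup.zero_mem _

theorem parity_of_repr (gr : ℤ × ℤ → AddSubgroup M)
    {ι : Type} [Fintype ι] (b : Module.Basis ι G.S M) (δ : ι → ℤ × ℤ)
    (h : ∀ d x, x ∈ gr d ↔ ∀ i, b.repr x i ∈ G.gr (d - δ i))
    (hδ : ∀ i, (δ i).1 ≡ (δ i).2 [ZMOD 2]) (d : ℤ × ℤ) (x : M) (hx : x ∈ gr d) (h0 : x ≠ 0) :
    d.1 ≡ d.2 [ZMOD 2] := by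
  obtain ⟨i, hi⟩ : ∃ i, b.repr x i ≠ 0 := by
    by_contra! hcon
    exact h0 (b.ext_elem fun i => by simpa using hcon i)
  simpa using (G.parity ((h d x).1 hx i) hi).add (hδ i)

end GradedModule

/-! ## Complexes over a grid ring -/

/-- A complex over the grid ring `S`: a finitely generated, graded free `ℤ × ℤ`-graded `S`-module
whose two degrees agree mod 2, with a differential of degree `(-1, -1)`. -/
structure SComplex (G : GridData.{u}) where
  carrier : Type u
  [addCommGroup : AddCommGroup carrier]
  [module : Module G.S carrier]
  gr : ℤ × ℤ → AddSubgroup carrier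
  isInternal : DirectSum.IsInternal gr
  smul_mem : ∀ d e : ℤ × ℤ, ∀ s ∈ G.gr d, ∀ x ∈ gr e, s • x ∈ gr (d + e)
  exists_basis : ∃ (ι : Type) (_ : Fintype ι) (b : Module.Basis ι G.S carrier),
    ∀ i, SetLike.IsHomogeneousElem gr (b i)
  parity : ∀ d : ℤ × ℤ, ∀ x ∈ gr d, x ≠ 0 → d.1 ≡ d.2 [ZMOD 2]
  diff : carrier →ₗ[G.S] carrier
  diff_mem : ∀ d : ℤ × ℤ, ∀ x ∈ gr d, diff x ∈ gr (d - (1, 1))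
  diff_diff : ∀ x, diff (diff x) = 0

attribute [instance] SComplex.addCommGroup SComplex.module

namespace SComplex

variable {G : GridData.{u}}

instance (C : SComplex G) : DirectSum.Decomposition C.gr := C.isInternal.chooseDecomposition

/-- The linear map `x ↦ (-1) ^ |x| x` on a complex. -/
def sign (C : SComplex G) : C.carrier →ₗ[G.S] C.carrier := gradedSign C.gr C.smul_mem

theorem sign_of_mem (C : SComplex G) {d : ℤ × ℤ} {x : C.carrier} (hx : x ∈ C.gr d) :
    C.sign x = (d.1.negOnePow : ℤ) • x :=
  gradedSign_of_mem C.gr C.smul_mem hx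

theorem sign_mem (C : SComplex G) {d : ℤ × ℤ} {x : C.carrier} (hx : x ∈ C.gr d) :
    C.sign x ∈ C.gr d := by
  rw [C.sign_of_mem hx]
  exact AddSubgroup.zsmul_mem _ hx _

theorem sign_sign (C : SComplex G) (x : C.carrier) : C.sign (C.sign x) = x := by
  induction x using DirectSum.Decomposition.inductionOn C.gr with
  | zero => simp
  | @homogeneous d x =>
    rw [C.sign_of_mem x.2, map_zsmul, C.sign_of_mem x.2, smul_smul, ← Units.val_mul,
      Int.units_mul_self, Units.val_one, one_smul]
  | add x y hx hy => simp only [map_add, hx, hy]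

theorem sign_diff (C : SComplex G) (x : C.carrier) : C.sign (C.diff x) = -C.diff (C.sign x) := by
  induction x using DirectSum.Decomposition.inductionOn C.gr with
  | zero => simp
  | @homogeneous d x =>
    rw [C.sign_of_mem x.2, C.sign_of_mem (C.diff_mem d _ x.2), Prod.fst_sub, Int.negOnePow_sub,
      map_zsmul]
    simp
  | add x y hx hy => simp only [map_add, hx, hy, neg_add]

instance : Nontrivial G.S :=
  haveI := G.typeZeroU.isDomain
  G.pU.domain_nontrivial

/-- A homogeneous basis, its degrees, and the description of the grading in coordinates. -/
theorem exists_repr (C : SComplex G) :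
    ∃ (ι : Type) (_ : Fintype ι) (b : Module.Basis ι G.S C.carrier) (δ : ι → ℤ × ℤ),
      (∀ d x, x ∈ C.gr d ↔ ∀ i, b.repr x i ∈ G.gr (d - δ i)) ∧
      ∀ i, (δ i).1 ≡ (δ i).2 [ZMOD 2] := by
  obtain ⟨ι, hι, b, hb⟩ := C.exists_basis
  choose δ hδ using hb
  exact ⟨ι, hι, b, δ, mem_gr_iff_repr C.gr C.smul_mem b δ hδ,
    fun i => C.parity _ _ (hδ i) (b.ne_zero i)⟩

/-! ### The trivial complex, tensor products and duals -/

/-- The trivial complex `S`, with zero differential. -/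
def trivial (G : GridData.{u}) : SComplex G where
  carrier := G.S
  gr := G.gr
  isInternal := DirectSum.Decomposition.isInternal G.gr
  smul_mem d e s hs x hx := SetLike.GradedMul.mul_mem hs hx
  exists_basis := ⟨Unit, inferInstance, Module.Basis.singleton Unit G.S, fun i =>
    ⟨0, by rw [Module.Basis.singleton_apply]; exact SetLike.GradedOne.one_mem⟩⟩
  parity d x hx h0 := G.parity hx h0
  diff := 0
  diff_mem d x _ := AddSubgroup.zero_mem _
  diff_diff x := rfl

/-- The grading of the tensor product: degree `n` is generated by the `x ⊗ y` with `x` and `y`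
homogeneous of degrees that add up to `n`. -/
def tensorGr (C D : SComplex G) (n : ℤ × ℤ) : AddSubgroup (C.carrier ⊗[G.S] D.carrier) :=
  AddSubgroup.closure {z | ∃ (i j : ℤ × ℤ) (x : C.carrier) (y : D.carrier),
    x ∈ C.gr i ∧ y ∈ D.gr j ∧ i + j = n ∧ z = x ⊗ₜ[G.S] y}

theorem tmul_mem_tensorGr (C D : SComplex G) {i j n : ℤ × ℤ} {x : C.carrier} {y : D.carrier}
    (hx : x ∈ C.gr i) (hy : y ∈ D.gr j) (h : i + j = n) : x ⊗ₜ[G.S] y ∈ C.tensorGr D n :=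
  AddSubgroup.subset_closure ⟨i, j, x, y, hx, hy, h, rfl⟩

theorem mem_tensorGr_iff_repr (C D : SComplex G) {ι κ : Type} [Fintype ι] [Fintype κ]
    (b : Module.Basis ι G.S C.carrier) (c : Module.Basis κ G.S D.carrier)
    (δ : ι → ℤ × ℤ) (ε : κ → ℤ × ℤ)
    (hb : ∀ d x, x ∈ C.gr d ↔ ∀ i, b.repr x i ∈ G.gr (d - δ i))
    (hc : ∀ d x, x ∈ D.gr d ↔ ∀ i, c.repr x i ∈ G.gr (d - ε i))
    (n : ℤ × ℤ) (z : C.carrier ⊗[G.S] D.carrier) :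
    z ∈ C.tensorGr D n ↔
      ∀ p : ι × κ, (b.tensorProduct c).repr z p ∈ G.gr (n - (δ p.1 + ε p.2)) := by
  constructor
  · intro hz p
    induction hz using AddSubgroup.closure_induction with
    | mem z hz =>
      obtain ⟨i, j, x, y, hx, hy, rfl, rfl⟩ := hz
      obtain ⟨k, l⟩ := p
      rw [Module.Basis.tensorProduct_repr_tmul_apply, smul_eq_mul, mul_comm]
      have h : i + j - (δ k + ε l) = (i - δ k) + (j - ε l) := by abel
      rw [h]
      exact SetLike.GradedMul.mul_mem ((hb i x).1 hx k) ((hc j y).1 hy l)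
    | zero => simp
    | add x y _ _ hx hy => rw [map_add, Finsupp.add_apply]; exact AddSubgroup.add_mem _ hx hy
    | neg x _ hx => rw [map_neg, Finsupp.neg_apply]; exact AddSubgroup.neg_mem _ hx
  · intro h
    rw [← (b.tensorProduct c).sum_repr z]
    refine AddSubgroup.sum_mem _ fun p _ => ?_
    rw [Module.Basis.tensorProduct_apply', TensorProduct.smul_tmul']
    exact C.tmul_mem_tensorGr D (C.smul_mem _ _ _ (h p) _ (basis_mem_of_repr C.gr b δ hb p.1))
      (basis_mem_of_repr D.gr c ε hc p.2) (by abel)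

theorem exists_repr_tensor (C D : SComplex G) :
    ∃ (ι : Type) (_ : Fintype ι) (b : Module.Basis ι G.S (C.carrier ⊗[G.S] D.carrier))
      (δ : ι → ℤ × ℤ), (∀ d x, x ∈ C.tensorGr D d ↔ ∀ i, b.repr x i ∈ G.gr (d - δ i)) ∧
      ∀ i, (δ i).1 ≡ (δ i).2 [ZMOD 2] := by
  obtain ⟨ι, hι, b, δ, hb, hδ⟩ := C.exists_repr
  obtain ⟨κ, hκ, c, ε, hc, hε⟩ := D.exists_repr
  exact ⟨ι × κ, inferInstance, b.tensorProduct c, fun p => δ p.1 + ε p.2,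
    C.mem_tensorGr_iff_repr D b c δ ε hb hc, fun p => (hδ p.1).add (hε p.2)⟩

/-- The tensor product complex, with `∂ (x ⊗ y) = ∂ x ⊗ y + (-1) ^ |x| x ⊗ ∂ y`. -/
def tensor (C D : SComplex G) : SComplex G where
  carrier := C.carrier ⊗[G.S] D.carrier
  gr := C.tensorGr D
  isInternal := by
    obtain ⟨ι, hι, b, δ, h, -⟩ := C.exists_repr_tensor D
    exact isInternal_of_repr _ b δ h
  smul_mem := by
    obtain ⟨ι, hι, b, δ, h, -⟩ := C.exists_repr_tensor D
    exact smul_mem_of_repr _ b δ h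
  exists_basis := by
    obtain ⟨ι, hι, b, δ, h, -⟩ := C.exists_repr_tensor D
    exact ⟨ι, hι, b, fun i => ⟨δ i, basis_mem_of_repr _ b δ h i⟩⟩
  parity := by
    obtain ⟨ι, hι, b, δ, h, hδ⟩ := C.exists_repr_tensor D
    exact parity_of_repr _ b δ h hδ
  diff := TensorProduct.map C.diff LinearMap.id + TensorProduct.map C.sign D.diff
  diff_mem d z hz := by
    induction hz using AddSubgroup.closure_induction with
    | mem z hz =>
      obtain ⟨i, j, x, y, hx, hy, rfl, rfl⟩ := hz
      rw [LinearMap.add_apply, TensorProduct.map_tmul, TensorProduct.map_tmul]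
      exact AddSubgroup.add_mem _
        (C.tmul_mem_tensorGr D (C.diff_mem _ _ hx) hy (by abel))
        (C.tmul_mem_tensorGr D (C.sign_mem hx) (D.diff_mem _ _ hy) (by abel))
    | zero => rw [map_zero]; exact AddSubgroup.zero_mem _
    | add x y _ _ hx hy => rw [map_add]; exact AddSubgroup.add_mem _ hx hy
    | neg x _ hx => rw [map_neg]; exact AddSubgroup.neg_mem _ hx
  diff_diff z := by
    induction z using TensorProduct.induction_on with
    | zero => simp
    | tmul x y =>
      simp [C.diff_diff, D.diff_diff, C.sign_diff, TensorProduct.neg_tmul]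
    | add x y hx hy => rw [map_add, map_add, hx, hy, add_zero]

/-- The grading of `Hom(C, S)`: a functional has degree `n` if it raises degrees by `n`. -/
def dualGr (C : SComplex G) (n : ℤ × ℤ) : AddSubgroup (Module.Dual G.S C.carrier) where
  carrier := {φ | ∀ d : ℤ × ℤ, ∀ x ∈ C.gr d, φ x ∈ G.gr (d + n)}
  add_mem' hφ hψ d x hx := AddSubgroup.add_mem _ (hφ d x hx) (hψ d x hx)
  zero_mem' _ _ _ := AddSubgroup.zero_mem _
  neg_mem' hφ d x hx := AddSubgroup.neg_mem _ (hφ d x hx)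

theorem exists_repr_dual (C : SComplex G) :
    ∃ (ι : Type) (_ : Fintype ι) (b : Module.Basis ι G.S (Module.Dual G.S C.carrier))
      (δ : ι → ℤ × ℤ), (∀ d φ, φ ∈ C.dualGr d ↔ ∀ i, b.repr φ i ∈ G.gr (d - δ i)) ∧
      ∀ i, (δ i).1 ≡ (δ i).2 [ZMOD 2] := by
  classical
  obtain ⟨ι, hι, b, δ, hb, hδ⟩ := C.exists_repr
  refine ⟨ι, hι, b.dualBasis, fun i => -δ i, fun d φ => ?_, fun i => (hδ i).neg⟩
  simp only [Module.Basis.dualBasis_repr, sub_neg_eq_add]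
  constructor
  · intro h i
    rw [add_comm]
    exact h _ _ (basis_mem_of_repr C.gr b δ hb i)
  · intro h e x hx
    rw [← b.sum_repr x, map_sum]
    refine AddSubgroup.sum_mem _ fun i _ => ?_
    rw [map_smul, smul_eq_mul]
    have he : e + d = (e - δ i) + (d + δ i) := by abel
    rw [he]
    exact SetLike.GradedMul.mul_mem ((hb e x).1 hx i) (h i)

theorem dualGr_isInternal (C : SComplex G) : DirectSum.IsInternal C.dualGr := by
  obtain ⟨ι, hι, b, δ, h, -⟩ := C.exists_repr_dual
  exact isInternal_of_repr _ b δ h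

instance (C : SComplex G) : DirectSum.Decomposition C.dualGr :=
  C.dualGr_isInternal.chooseDecomposition

theorem dualGr_smul_mem (C : SComplex G) :
    ∀ d e : ℤ × ℤ, ∀ s ∈ G.gr d, ∀ φ ∈ C.dualGr e, s • φ ∈ C.dualGr (d + e) := by
  obtain ⟨ι, hι, b, δ, h, -⟩ := C.exists_repr_dual
  exact smul_mem_of_repr _ b δ h

/-- The differential of the dual complex: `φ ↦ -(-1) ^ |φ| φ ∘ ∂`. -/
def dualDiff (C : SComplex G) : Module.Dual G.S C.carrier →ₗ[G.S] Module.Dual G.S C.carrier :=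
  -(C.diff.dualMap ∘ₗ gradedSign C.dualGr C.dualGr_smul_mem)

theorem dualDiff_of_mem (C : SComplex G) {n : ℤ × ℤ} {φ : Module.Dual G.S C.carrier}
    (hφ : φ ∈ C.dualGr n) : C.dualDiff φ = -((n.1.negOnePow : ℤ) • (φ ∘ₗ C.diff)) := by
  rw [dualDiff, LinearMap.neg_apply, LinearMap.comp_apply, gradedSign_of_mem _ _ hφ, map_zsmul]
  rfl

theorem dualDiff_mem (C : SComplex G) (n : ℤ × ℤ) (φ : Module.Dual G.S C.carrier)
    (hφ : φ ∈ C.dualGr n) : C.dualDiff φ ∈ C.dualGr (n - (1, 1)) := by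
  rw [C.dualDiff_of_mem hφ]
  refine AddSubgroup.neg_mem _ (AddSubgroup.zsmul_mem _ (fun d x hx => ?_) _)
  have h := hφ _ _ (C.diff_mem d x hx)
  have hd : d + (n - (1, 1)) = d - (1, 1) + n := by abel
  rw [hd]
  exact h

/-- The dual complex `Hom(C, S)`. -/
def dual (C : SComplex G) : SComplex G where
  carrier := Module.Dual G.S C.carrier
  gr := C.dualGr
  isInternal := C.dualGr_isInternal
  smul_mem := C.dualGr_smul_mem
  exists_basis := by
    obtain ⟨ι, hι, b, δ, h, -⟩ := C.exists_repr_dual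
    exact ⟨ι, hι, b, fun i => ⟨δ i, basis_mem_of_repr _ b δ h i⟩⟩
  parity := by
    obtain ⟨ι, hι, b, δ, h, hδ⟩ := C.exists_repr_dual
    exact parity_of_repr _ b δ h hδ
  diff := C.dualDiff
  diff_mem := C.dualDiff_mem
  diff_diff φ := by
    induction φ using DirectSum.Decomposition.inductionOn C.dualGr with
    | zero => simp
    | @homogeneous n φ =>
      have h2 : ((φ : Module.Dual G.S C.carrier) ∘ₗ C.diff) ∘ₗ C.diff = 0 := by
        ext x; simp [C.diff_diff]
      rw [C.dualDiff_of_mem (C.dualDiff_mem n _ φ.2), C.dualDiff_of_mem φ.2, LinearMap.neg_comp,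
        LinearMap.smul_comp, h2]
      simp
    | add x y hx hy => rw [map_add, map_add, hx, hy, add_zero]

/-! ### The tower conditions -/

/-- The differential of the complex `C ⊗ R`. -/
abbrev baseDiff (C : SComplex G) (R : Type u) [CommRing R] [Algebra G.S R] :
    R ⊗[G.S] C.carrier →ₗ[R] R ⊗[G.S] C.carrier :=
  C.diff.baseChange R

/-- The grading of `C ⊗ R` induced by a grading of `R`. -/
def baseGr (C : SComplex G) {R : Type u} [CommRing R] [Algebra G.S R]
    (𝒜 : ℤ × ℤ → AddSubgroup R) (n : ℤ × ℤ) : AddSubgroup (R ⊗[G.S] C.carrier) :=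
  AddSubgroup.closure {z | ∃ (i j : ℤ × ℤ) (r : R) (x : C.carrier),
    r ∈ 𝒜 i ∧ x ∈ C.gr j ∧ i + j = n ∧ z = r ⊗ₜ[G.S] x}

/-- Left knotlike: `H(C ⊗ RU) / torsion ≅ RU` by an isomorphism that preserves the second degree
and shifts the first degree by a constant. -/
def IsLeftKnotlike (C : SComplex G) : Prop :=
  ∃ (φ : HomologyModTorsion (C.baseDiff G.RU) ≃ₗ[G.RU] G.RU) (k : ℤ),
    ∀ (n : ℤ × ℤ) (z : LinearMap.ker (C.baseDiff G.RU)),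
      (z : G.RU ⊗[G.S] C.carrier) ∈ C.baseGr G.grU n →
      φ (HomologyModTorsion.mk _ z) ∈ G.grU (n + (k, 0))

/-- Right knotlike: `H(C ⊗ RV) / torsion ≅ RV` by an isomorphism that preserves the first degree
and shifts the second degree by a constant. -/
def IsRightKnotlike (C : SComplex G) : Prop :=
  ∃ (φ : HomologyModTorsion (C.baseDiff G.RV) ≃ₗ[G.RV] G.RV) (k : ℤ),
    ∀ (n : ℤ × ℤ) (z : LinearMap.ker (C.baseDiff G.RV)),
      (z : G.RV ⊗[G.S] C.carrier) ∈ C.baseGr G.grV n →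
      φ (HomologyModTorsion.mk _ z) ∈ G.grV (n + (0, k))

/-- Reduced: the differential vanishes modulo the ideal `(𝔪_U, 𝔪_V)`. -/
def IsReduced (C : SComplex G) : Prop :=
  ∀ x, C.diff x ∈ ((G.mU ⊔ G.mV) • ⊤ : Submodule G.S C.carrier)

/-- (Totally) knotlike complexes, with the convention that knotlike complexes are reduced. -/
structure IsKnotlike (C : SComplex G) : Prop where
  left : C.IsLeftKnotlike
  right : C.IsRightKnotlike
  reduced : C.IsReduced

/-! ### Local maps -/

/-- Chain maps: linear maps over the grid ring that commute with the differentials. -/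
structure ChainMap (C D : SComplex G) where
  toLinearMap : C.carrier →ₗ[G.S] D.carrier
  comm : ∀ x, toLinearMap (C.diff x) = D.diff (toLinearMap x)

namespace ChainMap

variable {C D E : SComplex G}

/-- The identity chain map. -/
def id (C : SComplex G) : ChainMap C C := ⟨LinearMap.id, fun _ => rfl⟩

/-- The composition of chain maps. -/
def comp (g : ChainMap D E) (f : ChainMap C D) : ChainMap C E :=
  ⟨g.toLinearMap ∘ₗ f.toLinearMap, fun x => by simp [f.comm, g.comm]⟩

theorem baseChange_comm (f : ChainMap C D) (R : Type u) [CommRing R] [Algebra G.S R]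
    (z : R ⊗[G.S] C.carrier) :
    f.toLinearMap.baseChange R (C.baseDiff R z) = D.baseDiff R (f.toLinearMap.baseChange R z) := by
  induction z using TensorProduct.induction_on with
  | zero => simp
  | tmul r x => simp [f.comm]
  | add x y hx hy => simp only [map_add, hx, hy]

/-- The map on the homology of `C ⊗ R` modulo torsion induced by a chain map. -/
def homologyModTorsionMap (f : ChainMap C D) (R : Type u) [CommRing R] [Algebra G.S R] :
    HomologyModTorsion (C.baseDiff R) →ₗ[R] HomologyModTorsion (D.baseDiff R) :=
  HomologyModTorsion.map (f.toLinearMap.baseChange R) (f.baseChange_comm R)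

theorem homologyModTorsionMap_id (R : Type u) [CommRing R] [Algebra G.S R]
    (x : HomologyModTorsion (C.baseDiff R)) : (ChainMap.id C).homologyModTorsionMap R x = x := by
  obtain ⟨z, rfl⟩ := HomologyModTorsion.mk_surjective _ x
  rw [homologyModTorsionMap, HomologyModTorsion.map_mk]
  congr 1
  apply Subtype.ext
  exact LinearMap.congr_fun (LinearMap.baseChange_id (R := G.S) (A := R) (M := C.carrier)) z.1

theorem homologyModTorsionMap_comp (g : ChainMap D E) (f : ChainMap C D)
    (R : Type u) [CommRing R] [Algebra G.S R] (x : HomologyModTorsion (C.baseDiff R)) :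
    (g.comp f).homologyModTorsionMap R x =
      g.homologyModTorsionMap R (f.homologyModTorsionMap R x) := by
  obtain ⟨z, rfl⟩ := HomologyModTorsion.mk_surjective _ x
  simp only [homologyModTorsionMap, HomologyModTorsion.map_mk]
  congr 1
  apply Subtype.ext
  exact LinearMap.congr_fun (LinearMap.baseChange_comp f.toLinearMap g.toLinearMap) z.1

/-- (Right) local maps: chain maps that preserve the first degree, shift the second degree by a
constant, and induce an isomorphism on `H(- ⊗ RV) / torsion`. -/
structure IsLocal (f : ChainMap C D) : Prop where
  degree : ∃ k : ℤ, ∀ n : ℤ × ℤ, ∀ x ∈ C.gr n, f.toLinearMap x ∈ D.gr (n + (0, k))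
  bijective : Function.Bijective (f.homologyModTorsionMap G.RV)

theorem isLocal_id (C : SComplex G) : (ChainMap.id C).IsLocal where
  degree := ⟨0, fun n x hx => by
    have h : n + ((0 : ℤ), (0 : ℤ)) = n := add_zero n
    rw [h]
    exact hx⟩
  bijective := by
    have h : ⇑((ChainMap.id C).homologyModTorsionMap G.RV) = _root_.id :=
      funext (homologyModTorsionMap_id G.RV)
    rw [h]
    exact Function.bijective_id

theorem IsLocal.comp {g : ChainMap D E} {f : ChainMap C D} (hg : g.IsLocal) (hf : f.IsLocal) :
    (g.comp f).IsLocal where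
  degree := by
    obtain ⟨k, hk⟩ := hf.degree
    obtain ⟨l, hl⟩ := hg.degree
    refine ⟨k + l, fun n x hx => ?_⟩
    have h : n + (0, k + l) = n + (0, k) + (0, l) := by ext <;> simp [add_assoc]
    rw [h]
    exact hl _ _ (hk n x hx)
  bijective := by
    have h : ⇑((g.comp f).homologyModTorsionMap G.RV) =
        g.homologyModTorsionMap G.RV ∘ f.homologyModTorsionMap G.RV :=
      funext (homologyModTorsionMap_comp g f G.RV)
    rw [h]
    exact hg.bijective.comp hf.bijective

end ChainMap

end SComplex

/-! ## Local equivalence classes -/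

/-- The knotlike complexes over a grid ring. -/
def KnotlikeComplex (G : GridData.{u}) : Type (u + 1) := {C : SComplex G // C.IsKnotlike}

/-- (Right) local equivalence: there are local maps in both directions. -/
instance localEquivalence (G : GridData.{u}) : Setoid (KnotlikeComplex G) where
  r C D := (∃ f : SComplex.ChainMap C.1 D.1, f.IsLocal) ∧
    ∃ f : SComplex.ChainMap D.1 C.1, f.IsLocal
  iseqv :=
    { refl := fun C => ⟨⟨_, SComplex.ChainMap.isLocal_id C.1⟩, ⟨_, SComplex.ChainMap.isLocal_id C.1⟩⟩
      symm := fun h => ⟨h.2, h.1⟩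
      trans := fun ⟨⟨_, hf⟩, ⟨_, hf'⟩⟩ ⟨⟨_, hg⟩, ⟨_, hg'⟩⟩ => ⟨⟨_, hg.comp hf⟩, ⟨_, hf'.comp hg'⟩⟩ }

/-- The set of (right) local equivalence classes of (totally) knotlike complexes. -/
def LocalEquivalenceClass (G : GridData.{u}) : Type (u + 1) := Quotient (localEquivalence G)

/-- The local equivalence class of a knotlike complex. -/
def LocalEquivalenceClass.mk {G : GridData.{u}} (C : SComplex G) (hC : C.IsKnotlike) :
    LocalEquivalenceClass G :=
  Quotient.mk (localEquivalence G) ⟨C, hC⟩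

end

/-! Over a graded valuation ring `R`, finitely generated free graded modules allow Gaussian
elimination: among the values of a homogeneous functional on a homogeneous basis, one divides all
the others and serves as a pivot. Hence the kernel of a homogeneous endomorphism is a graded direct
summand (`exists_graded_retraction`). Applied to the cycles of `C ⊗ R`, for `R` equal to `RU` or
`RV`, this turns the condition that homology modulo torsion is `R` into chain-level data: a
homogeneous cycle `x`, a homogeneous cocycle `p` with `p x = 1`, a homotopy `h` and a nonzero scalar
`a` with `dh + hd = a (1 - p(-) x)`. Conversely, such data identify homology modulo torsion with `R`
through `p`. This is `HomologySplitting`, and `isTower_iff` is the equivalence. Only `x` and `p`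
have to be homogeneous.

Splittings replace the Künneth and universal coefficient theorems. The tensor product of two
splittings has cycle `x ⊗ x'` and cocycle `p ⊗ p'`; the dual splitting has cycle `p` and evaluation
at `x` as cocycle. The homotopies are explicit, provided that `h` anticommutes with the sign
operator `σ`, which can be arranged by averaging (`exists_anticomm`).

Under the identifications with `R`, a chain map `f` acts as multiplication by the scalar `p' (f x)`,
so a map of the required degree is local exactly when this scalar is a unit
(`GradedSplitting.isLocal_iff`). These scalars multiply under tensor products and are unchanged
under transposition. For the evaluation `C ⊗ C^∨ → S` the scalar is `p (σ x) = ±1`; for the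
coevaluation `1 ↦ ∑ b_i ⊗ b_i^*` it is `∑ p(b_i) b_i^*(x) = p x = 1`. So `[C^∨]` inverts `[C]`. The
remaining group laws come from the usual isomorphisms of complexes.

All sign questions rest on one fact: a homogeneous scalar of degree `d` is fixed by `(-1) ^ d.1`,
because nonzero scalars have even degrees unless `-1 = 1`. -/

noncomputable section

/-! ## Graded linear algebra over a graded valuation ring -/

section GradedLinearAlgebra

variable {R : Type u} [CommRing R] (𝒜 : ℤ × ℤ → AddSubgroup R) [GradedRing 𝒜]

/-- A homogeneous multiple of a homogeneous element is a multiple by a homogeneous element. -/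
theorem exists_homogeneous_factor {x y : R} {i j : ℤ × ℤ} (hx : x ∈ 𝒜 i) (hy : y ∈ 𝒜 j)
    (h : x ∣ y) : ∃ c ∈ 𝒜 (j - i), y = x * c := by
  obtain ⟨c, rfl⟩ := h
  -- The given cofactor may have several components; multiplied by `x`, only the one of degree `j -
  -- i` contributes in degree `j`.
  refine ⟨DirectSum.decompose 𝒜 c (j - i), SetLike.coe_mem _, ?_⟩
  rw [← DirectSum.coe_decompose_mul_add_of_left_mem 𝒜 hx, add_sub_cancel,
    DirectSum.decompose_of_mem_same 𝒜 hy]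

/-- Iterating total divisibility over a finite family yields the pivot for elimination. -/
theorem IsGradedValuationRing.exists_forall_dvd {𝒜 : ℤ × ℤ → AddSubgroup R} [GradedRing 𝒜]
    (h𝒜 : IsGradedValuationRing 𝒜) {ι : Type} [Fintype ι] [Nonempty ι] (v : ι → R)
    (hv : ∀ i, SetLike.IsHomogeneousElem 𝒜 (v i)) : ∃ i, ∀ j, v i ∣ v j := by
  classical
  have key : ∀ s : Finset ι, s.Nonempty → ∃ i, ∀ j ∈ s, v i ∣ v j := by
    intro s hs
    induction hs using Finset.Nonempty.cons_induction with
    | singleton a => exact ⟨a, by simp⟩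
    | cons a s ha hs ih =>
      obtain ⟨i, hi⟩ := ih
      rcases h𝒜.dvd_total _ _ (hv i) (hv a) with h | h
      · exact ⟨i, by simpa using ⟨h, hi⟩⟩
      · exact ⟨a, by simpa using fun j hj => h.trans (hi j hj)⟩
  obtain ⟨i, hi⟩ := key Finset.univ Finset.univ_nonempty
  exact ⟨i, fun j => hi j (Finset.mem_univ j)⟩

variable {𝒜} {M : Type u} [AddCommGroup M] [Module R M] {gr : ℤ × ℤ → AddSubgroup M}
  {ι : Type} {b : Module.Basis ι R M} {δ : ι → ℤ × ℤ}

theorem smul_mem_of_coord (hgr : ∀ n x, x ∈ gr n ↔ ∀ i, b.repr x i ∈ 𝒜 (n - δ i))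
    {m n : ℤ × ℤ} {r : R} {x : M} (hr : r ∈ 𝒜 m) (hx : x ∈ gr n) : r • x ∈ gr (m + n) := by
  refine (hgr _ _).2 fun i => ?_
  rw [map_smul, Finsupp.smul_apply, smul_eq_mul, add_sub_assoc]
  exact SetLike.GradedMul.mul_mem hr ((hgr n x).1 hx i)

theorem basis_mem_of_coord (hgr : ∀ n x, x ∈ gr n ↔ ∀ i, b.repr x i ∈ 𝒜 (n - δ i)) (i : ι) :
    b i ∈ gr (δ i) := by
  classical
  refine (hgr _ _).2 fun j => ?_
  rw [b.repr_self, Finsupp.single_apply]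
  split_ifs with hij
  · subst hij; rw [sub_self]; exact SetLike.GradedOne.one_mem
  · exact AddSubgroup.zero_mem _

/-- The common kernel of finitely many homogeneous functionals is a graded retract. -/
theorem exists_graded_retraction_functionals [Fintype ι] (h𝒜 : IsGradedValuationRing 𝒜)
    (hgr : ∀ n x, x ∈ gr n ↔ ∀ i, b.repr x i ∈ 𝒜 (n - δ i))
    {κ : Type} (ψ : κ → M →ₗ[R] R) (w : κ → ℤ × ℤ)
    (hψ : ∀ k n, ∀ x ∈ gr n, ψ k x ∈ 𝒜 (n + w k)) (s : Finset κ) :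
    ∃ π : M →ₗ[R] M, (∀ n, ∀ x ∈ gr n, π x ∈ gr n) ∧ (∀ k ∈ s, ∀ x, ψ k (π x) = 0) ∧
      ∀ x, (∀ k ∈ s, ψ k x = 0) → π x = x := by
  classical
  have := h𝒜.isDomain
  induction s using Finset.induction_on with
  | empty => exact ⟨LinearMap.id, by simp⟩
  | insert k s hk ih =>
    obtain ⟨π, hπ, hker, hid⟩ := ih
    rcases isEmpty_or_nonempty ι with hι | hι
    · have hM : ∀ x : M, x = 0 := fun x => b.ext_elem fun i => (hι.false i).elim
      exact ⟨π, hπ, fun _ _ x => by rw [hM (π x), map_zero], fun x _ => by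
        rw [hM x, map_zero]⟩
    have hmem : ∀ i, ψ k (π (b i)) ∈ 𝒜 (δ i + w k) := fun i =>
      hψ k _ _ (hπ _ _ (basis_mem_of_coord hgr i))
    -- Elimination on the image of the retraction `π` already built: the pivot is the value of `ψ k`
    -- that divides all the others. If it vanishes, so does `ψ k` on that image, and `π` needs no
    -- change.
    obtain ⟨i₀, hi₀⟩ := h𝒜.exists_forall_dvd (fun i => ψ k (π (b i))) fun i => ⟨_, hmem i⟩
    by_cases h0 : ψ k (π (b i₀)) = 0
    · have hz : ∀ x, ψ k (π x) = 0 := by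
        have : ψ k ∘ₗ π = 0 := b.ext fun i => by
          have := hi₀ i
          simp only [h0, zero_dvd_iff] at this
          simpa using this
        exact fun x => LinearMap.congr_fun this x
      refine ⟨π, hπ, fun l hl x => ?_, fun x hx => hid x fun l hl => hx l (by simp [hl])⟩
      rcases Finset.mem_insert.1 hl with rfl | hl
      · exact hz x
      · exact hker l hl x
    choose c hc hcv using fun i => exists_homogeneous_factor 𝒜 (hmem i₀) (hmem i) (hi₀ i)
    -- The homogeneous functional with `ψ k ∘ π` equal to the pivot value times `q`; division by the
    -- pivot happens here, once.
    let q : M →ₗ[R] R := b.constr ℕ c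
    have hq : ∀ x, ψ k (π x) = q x * ψ k (π (b i₀)) := by
      have : ψ k ∘ₗ π = (LinearMap.lsmul R R (ψ k (π (b i₀)))) ∘ₗ q := b.ext fun i => by
        simp [q, ← hcv i]
      intro x
      have := LinearMap.congr_fun this x
      simpa [mul_comm] using this
    have hqmem : ∀ n, ∀ x ∈ gr n, q x ∈ 𝒜 (n - δ i₀) := by
      intro n x hx
      rw [Module.Basis.constr_apply_fintype]
      refine AddSubgroup.sum_mem _ fun i _ => ?_
      have := SetLike.GradedMul.mul_mem ((hgr n x).1 hx i) (hc i)
      have h' : n - δ i + (δ i + w k - (δ i₀ + w k)) = n - δ i₀ := by abel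
      rw [h'] at this
      simpa using this
    have hππ : ∀ x, π (π x) = π x := fun x => hid _ fun l hl => hker l hl x
    -- Subtract the multiple of the pivot vector that cancels `ψ k`. Where `ψ k` already vanishes,
    -- `q` vanishes too since the pivot value is nonzero in a domain, so such vectors stay fixed.
    refine ⟨π - (q ∘ₗ π).smulRight (π (b i₀)), fun n x hx => ?_, fun l hl x => ?_, fun x hx => ?_⟩
    · have h1 := smul_mem_of_coord hgr (hqmem _ _ (hπ _ _ hx))
        (hπ _ _ (basis_mem_of_coord hgr i₀))
      rw [sub_add_cancel] at h1
      exact AddSubgroup.sub_mem _ (hπ _ _ hx) h1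
    · simp only [LinearMap.sub_apply, LinearMap.smulRight_apply, LinearMap.comp_apply, map_sub,
        map_smul, smul_eq_mul]
      rcases Finset.mem_insert.1 hl with rfl | hl
      · rw [← hq, hππ, sub_self]
      · simp [hker l hl]
    · have hx' : π x = x := hid x fun l hl => hx l (by simp [hl])
      have h1 : q x = 0 := by
        have := hq x
        rw [hx', hx k (by simp)] at this
        exact (mul_eq_zero.1 this.symm).resolve_right h0
      simp [hx', h1]

/-- The kernel of a homogeneous endomorphism is a graded retract. -/
theorem exists_graded_retraction [Fintype ι] (h𝒜 : IsGradedValuationRing 𝒜)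
    (hgr : ∀ n x, x ∈ gr n ↔ ∀ i, b.repr x i ∈ 𝒜 (n - δ i)) (d : M →ₗ[R] M) (w : ℤ × ℤ)
    (hd : ∀ n, ∀ x ∈ gr n, d x ∈ gr (n + w)) :
    ∃ π : M →ₗ[R] M, (∀ n, ∀ x ∈ gr n, π x ∈ gr n) ∧ (∀ x, d (π x) = 0) ∧
      ∀ x, d x = 0 → π x = x := by
  obtain ⟨π, h1, h2, h3⟩ := exists_graded_retraction_functionals h𝒜 hgr
    (fun i => b.coord i ∘ₗ d) (fun i => w - δ i) (fun i n x hx => by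
      have := (hgr _ _).1 (hd n x hx) i
      rw [add_sub_assoc] at this
      exact this) Finset.univ
  refine ⟨π, h1, fun x => b.ext_elem fun i => ?_, fun x hx => h3 x fun i _ => by simp [hx]⟩
  simpa using h2 i (Finset.mem_univ i) x

/-- A homogeneous functional that takes the value `1` does so at a homogeneous element. -/
theorem exists_homogeneous_of_apply_eq_one [Fintype ι]
    (hgr : ∀ n x, x ∈ gr n ↔ ∀ i, b.repr x i ∈ 𝒜 (n - δ i)) (p : M →ₗ[R] R) (w : ℤ × ℤ)
    (hp : ∀ n, ∀ x ∈ gr n, p x ∈ 𝒜 (n + w)) {y : M} (hy : p y = 1) :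
    ∃ x ∈ gr (-w), p x = 1 := by
  -- This is the component of `y` of degree `-w`. As `p` raises degrees by `w`, it is sent to the
  -- degree-zero component of `p y = 1`.
  refine ⟨∑ i, (DirectSum.decompose 𝒜 (b.repr y i) (-w - δ i) : R) • b i,
    AddSubgroup.sum_mem _ fun i _ => ?_, ?_⟩
  · have := smul_mem_of_coord hgr (SetLike.coe_mem (DirectSum.decompose 𝒜 (b.repr y i) (-w - δ i)))
      (basis_mem_of_coord hgr i)
    rwa [sub_add_cancel] at this
  · have h1 : (DirectSum.decompose 𝒜 (p y) 0 : R) = 1 := by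
      rw [hy, DirectSum.decompose_of_mem_same 𝒜 SetLike.GradedOne.one_mem]
    rw [← h1]
    conv_rhs => rw [← b.sum_repr y, map_sum]
    rw [DirectSum.decompose_sum, DFinsupp.finsetSum_apply, AddSubgroup.val_finsetSum, map_sum]
    refine Finset.sum_congr rfl fun i _ => ?_
    rw [map_smul, map_smul, smul_eq_mul, smul_eq_mul, ← DirectSum.coe_decompose_mul_add_of_right_mem 𝒜
      (hp _ _ (basis_mem_of_coord hgr i))]
    have h2 : -w - δ i + (δ i + w) = 0 := by abel
    exact congrArg (fun j => (DirectSum.decompose 𝒜 (b.repr y i * p (b i)) j : R)) h2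

theorem IsGradedDomain.negOnePow_smul (h𝒜 : IsGradedDomain 𝒜) {d : ℤ × ℤ} {r : R}
    (hr : r ∈ 𝒜 d) : (d.1.negOnePow : ℤ) • r = r := by
  rcases h𝒜.even_or_neg_one with h | h
  · by_cases h0 : r = 0
    · simp [h0]
    · rw [Int.negOnePow_even _ (h d _ hr h0).1]; simp
  · rcases Int.even_or_odd d.1 with hd | hd
    · rw [Int.negOnePow_even _ hd]; simp
    · rw [Int.negOnePow_odd _ hd]
      simpa using congrArg (· * r) h

end GradedLinearAlgebra

/-! ## Splittings of the homology modulo torsion -/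

/-- A cycle `x` and a cocycle `p` with `p x = 1` such that, up to a nonzero factor `a`, the
projection `p(-) x` is chain homotopic to the identity. -/
structure HomologySplitting {R : Type u} [CommRing R] {M : Type u} [AddCommGroup M] [Module R M]
    (d : M →ₗ[R] M) where
  x : M
  p : M →ₗ[R] R
  h : M →ₗ[R] M
  a : R
  diff_x : d x = 0
  p_diff : ∀ z, p (d z) = 0
  p_x : p x = 1
  a_ne_zero : a ≠ 0
  homotopy : ∀ z, d (h z) + h (d z) = a • (z - p z • x)

namespace HomologySplitting

variable {R : Type u} [CommRing R] {M N : Type u} [AddCommGroup M] [Module R M]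
  [AddCommGroup N] [Module R N]

/-! ### Homology modulo torsion and induced maps, read off from a splitting -/

section Equiv

variable [IsDomain R] {d : M →ₗ[R] M} (s : HomologySplitting d)

/-- The map on homology induced by the cocycle of a splitting. -/
def homologyToRing : Homology d →ₗ[R] R :=
  Submodule.liftQ _ (s.p ∘ₗ (LinearMap.ker d).subtype) (by
    rintro z ⟨w, hw⟩
    have : s.p (z : M) = 0 := by
      have hw' : d w = z := hw
      rw [← hw', s.p_diff]
    simpa using this)

/-- The map on homology modulo torsion induced by the cocycle of a splitting. -/
def toRing : HomologyModTorsion d →ₗ[R] R :=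
  Submodule.liftQ _ s.homologyToRing (by
    rintro z ⟨a, ha⟩
    have h1 : a • z = 0 := ha
    rw [LinearMap.mem_ker]
    have h2 := congrArg s.homologyToRing h1
    rw [Submonoid.smul_def, map_smul, map_zero, smul_eq_mul] at h2
    exact (mul_eq_zero.1 h2).resolve_left (nonZeroDivisors.ne_zero a.2))

theorem toRing_mk (z : LinearMap.ker d) : s.toRing (HomologyModTorsion.mk d z) = s.p z := rfl

/-- On a cycle `z` with `p z = 0` the homotopy identity reads `d (h z) = a z`, so the class of `z`
is torsion; surjectivity comes from `p x = 1`. -/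
theorem toRing_bijective : Function.Bijective s.toRing := by
  constructor
  · rw [injective_iff_map_eq_zero]
    intro y hy
    obtain ⟨z, rfl⟩ := HomologyModTorsion.mk_surjective _ y
    rw [toRing_mk] at hy
    have hz : d z = 0 := z.2
    have h1 := s.homotopy z
    rw [hz, map_zero, add_zero, hy, zero_smul, sub_zero] at h1
    rw [HomologyModTorsion.mk, LinearMap.comp_apply, Submodule.mkQ_apply,
      Submodule.Quotient.mk_eq_zero]
    refine ⟨⟨s.a, mem_nonZeroDivisors_of_ne_zero s.a_ne_zero⟩, ?_⟩
    rw [Submonoid.smul_def, ← map_smul, Submodule.mkQ_apply, Submodule.Quotient.mk_eq_zero]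
    exact ⟨s.h z, h1⟩
  · intro r
    refine ⟨r • HomologyModTorsion.mk d ⟨s.x, s.diff_x⟩, ?_⟩
    rw [map_smul, toRing_mk, s.p_x, smul_eq_mul, mul_one]

/-- A splitting identifies the homology modulo torsion with the ring. -/
def equiv : HomologyModTorsion d ≃ₗ[R] R := LinearEquiv.ofBijective s.toRing s.toRing_bijective

theorem equiv_mk (z : LinearMap.ker d) : s.equiv (HomologyModTorsion.mk d z) = s.p z := rfl

/-- In terms of splittings, a chain map induces an isomorphism on homology modulo torsion if and
only if the coefficient `p' (f x)` is invertible. -/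
theorem bijective_map_iff {d' : N →ₗ[R] N} (t : HomologySplitting d') (f : M →ₗ[R] N)
    (hf : ∀ x, f (d x) = d' (f x)) :
    Function.Bijective (HomologyModTorsion.map f hf) ↔ IsUnit (t.p (f s.x)) := by
  -- The class of `x` is a basis, so the induced map is determined by its value there: it is
  -- multiplication by `t.p (f s.x)`.
  have key : ∀ y, t.equiv (HomologyModTorsion.map f hf y) = s.equiv y * t.p (f s.x) := by
    intro y
    have h1 : y = s.equiv y • HomologyModTorsion.mk d ⟨s.x, s.diff_x⟩ := by
      apply s.equiv.injective
      rw [map_smul, equiv_mk, s.p_x, smul_eq_mul, mul_one]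
    conv_lhs => rw [h1]
    rw [map_smul, map_smul, HomologyModTorsion.map_mk, equiv_mk]
    rfl
  have h2 : Function.Bijective (HomologyModTorsion.map f hf) ↔
      Function.Bijective (fun r : R => r * t.p (f s.x)) := by
    have h3 : (fun r : R => r * t.p (f s.x)) ∘ s.equiv =
        t.equiv ∘ HomologyModTorsion.map f hf := funext fun y => (key y).symm
    rw [← Function.Bijective.of_comp_iff _ s.equiv.bijective, h3,
      Function.Bijective.of_comp_iff' t.equiv.bijective]
  rw [h2]
  constructor
  · intro h
    obtain ⟨r, hr⟩ := h.2 1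
    exact IsUnit.of_mul_eq_one r (by rw [mul_comm]; exact hr)
  · exact fun h => h.unit.mulRight_bijective

end Equiv

/-! ### Construction of splittings -/

/-- Existence of splittings: a generator of the homology modulo torsion gives a splitting as soon
as the cycles are a direct summand. -/
theorem exists_of_equiv [IsDomain R] {ι : Type} [Fintype ι] (b : Module.Basis ι R M)
    {d : M →ₗ[R] M} (hdd : ∀ z, d (d z) = 0) (π : M →ₗ[R] M) (hπ : ∀ z, d (π z) = 0)
    (hid : ∀ z, d z = 0 → π z = z) (φ : HomologyModTorsion d ≃ₗ[R] R)
    (x : M) (hx : d x = 0) (hφ : φ (HomologyModTorsion.mk d ⟨x, hx⟩) = 1) :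
    ∃ s : HomologySplitting d, s.x = x ∧
      ∀ z, s.p z = φ (HomologyModTorsion.mk d ⟨π z, hπ z⟩) := by
  classical
  -- The retraction onto cycles extends `φ` from cycles to a functional on all of `M`.
  let p : M →ₗ[R] R := φ.toLinearMap ∘ₗ HomologyModTorsion.mk d ∘ₗ π.codRestrict _ hπ
  have hp : ∀ z, p z = φ (HomologyModTorsion.mk d ⟨π z, hπ z⟩) := fun z => rfl
  have hpz : ∀ z (hz : d z = 0), p z = φ (HomologyModTorsion.mk d ⟨z, hz⟩) := by
    intro z hz
    rw [hp]
    congr 3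
    exact hid z hz
  have hpx : p x = 1 := by rw [hpz x hx, hφ]
  have hpd : ∀ z, p (d z) = 0 := by
    intro z
    rw [hpz _ (hdd z)]
    have h1 : HomologyModTorsion.mk d ⟨d z, hdd z⟩ = 0 := by
      rw [HomologyModTorsion.mk, LinearMap.comp_apply]
      have : ((LinearMap.range d).submoduleOf (LinearMap.ker d)).mkQ ⟨d z, hdd z⟩ = 0 := by
        rw [Submodule.mkQ_apply, Submodule.Quotient.mk_eq_zero]
        exact ⟨z, rfl⟩
      rw [this, map_zero]
    rw [h1, map_zero]
  have hpπ : ∀ z, p (π z) = p z := fun z => by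
    rw [hp, hp]
    congr 3
    exact hid _ (hπ z)
  -- The cycle `π z - p z • x` is killed by `p`, hence its class is torsion by injectivity of `φ`.
  have htors : ∀ z, ∃ a : R, a ≠ 0 ∧ ∃ c, d c = a • (π z - p z • x) := by
    intro z
    have hcyc : d (π z - p z • x) = 0 := by rw [map_sub, map_smul, hπ, hx, smul_zero, sub_zero]
    have h0 : HomologyModTorsion.mk d ⟨_, hcyc⟩ = 0 := by
      apply φ.injective
      rw [map_zero, ← hpz, map_sub, map_smul, hpx, hpπ]
      simp
    rw [HomologyModTorsion.mk, LinearMap.comp_apply, Submodule.mkQ_apply,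
      Submodule.Quotient.mk_eq_zero] at h0
    obtain ⟨a, ha⟩ := h0
    rw [Submonoid.smul_def, ← map_smul, Submodule.mkQ_apply, Submodule.Quotient.mk_eq_zero] at ha
    obtain ⟨c, hc⟩ := ha
    exact ⟨a, nonZeroDivisors.ne_zero a.2, c, hc⟩
  choose a ha c hc using htors
  -- The product of the annihilators on the finite basis works uniformly; the cofactors in `h₀`
  -- bring each basis vector to this common scalar.
  let A : R := ∏ i, a (b i)
  have hA : A ≠ 0 := Finset.prod_ne_zero_iff.2 fun i _ => ha _
  let h₀ : M →ₗ[R] M := b.constr ℕ fun i => (∏ j ∈ Finset.univ.erase i, a (b j)) • c (b i)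
  have hh₀ : ∀ z, d (h₀ z) = A • (π z - p z • x) := by
    have : d ∘ₗ h₀ = A • (π - p.smulRight x) := b.ext fun i => by
      simp only [h₀, LinearMap.comp_apply, Module.Basis.constr_basis, map_smul, hc,
        LinearMap.smul_apply, LinearMap.sub_apply, LinearMap.smulRight_apply, smul_smul]
      congr 1
      exact Finset.prod_erase_mul _ (fun j => a (b j)) (Finset.mem_univ i)
    exact fun z => LinearMap.congr_fun this z
  -- `h₀` satisfies the required identity only on cycles. In `h = (1 - π) h₀ π`, the term `d h`
  -- gives `A (π - p(-) x)`, while `h d` must supply the missing `A (1 - π)`.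
  refine ⟨⟨x, p, (LinearMap.id - π) ∘ₗ h₀ ∘ₗ π, A, hx, hpd, hpx, hA, fun z => ?_⟩, rfl, hp⟩
  -- Since `h₀ (d z) - A z` is a cycle, `π` fixes it; this gives `(1 - π) h₀ d = A (1 - π)`.
  have h1 : d (h₀ (d z) - A • z) = 0 := by
    rw [map_sub, hh₀, hpd, hid _ (hdd z), zero_smul, sub_zero, map_smul, sub_self]
  have h2 := hid _ h1
  rw [map_sub, map_smul] at h2
  simp only [LinearMap.comp_apply, LinearMap.sub_apply, LinearMap.id_apply, map_sub, hπ, hh₀,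
    hid _ (hdd z), hid _ (hπ z), hpπ, sub_zero]
  have h3 : h₀ (d z) - π (h₀ (d z)) = A • z - A • π z := by
    rw [sub_eq_sub_iff_add_eq_add] at h2 ⊢
    rw [← sub_eq_zero] at h2 ⊢
    rw [← neg_eq_zero, ← h2]
    abel
  rw [h3]
  simp only [smul_sub]
  abel

/-! ### Transport, tensor products and duals of splittings -/

/-- Transport of a splitting along an isomorphism of complexes. -/
def congr {d : M →ₗ[R] M} {d' : N →ₗ[R] N} (s : HomologySplitting d) (e : M ≃ₗ[R] N)
    (he : ∀ z, e (d z) = d' (e z)) : HomologySplitting d' where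
  x := e s.x
  p := s.p ∘ₗ e.symm.toLinearMap
  h := e.toLinearMap ∘ₗ s.h ∘ₗ e.symm.toLinearMap
  a := s.a
  diff_x := by rw [← he, s.diff_x, map_zero]
  p_diff z := by
    obtain ⟨z, rfl⟩ := e.surjective z
    simp [← he, s.p_diff]
  p_x := by simp [s.p_x]
  a_ne_zero := s.a_ne_zero
  homotopy z := by
    obtain ⟨z, rfl⟩ := e.surjective z
    have := congrArg e (s.homotopy z)
    simpa [← he] using this

/-- The homotopy of a splitting can be made to anticommute with a sign operator. -/
theorem exists_anticomm [IsDomain R] {d : M →ₗ[R] M} (s : HomologySplitting d) (σ : M →ₗ[R] M)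
    (hσσ : ∀ z, σ (σ z) = z) (hσd : ∀ z, σ (d z) = -d (σ z))
    (hσ : ∀ z, σ (s.p z • s.x) = s.p (σ z) • s.x) (hσ2 : (2 : R) = 0 → ∀ z, σ z = z) :
    ∃ t : HomologySplitting d, t.x = s.x ∧ t.p = s.p ∧ ∀ z, σ (t.h z) = -t.h (σ z) := by
  by_cases h2 : (2 : R) = 0
  · refine ⟨s, rfl, rfl, fun z => ?_⟩
    rw [hσ2 h2, hσ2 h2, eq_neg_iff_add_eq_zero, ← two_smul R, h2, zero_smul]
  -- Antisymmetrize `h` under conjugation by `σ`. As `σ` anticommutes with `d` and commutes with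
  -- `p(-) x`, the second term is also a homotopy with factor `a`, so the factor doubles to `2a`,
  -- nonzero in this case.
  · refine ⟨⟨s.x, s.p, s.h - σ ∘ₗ s.h ∘ₗ σ, 2 * s.a, s.diff_x, s.p_diff, s.p_x,
      mul_ne_zero h2 s.a_ne_zero, fun z => ?_⟩, rfl, rfl, fun z => ?_⟩
    · have hdσ : ∀ z, d (σ z) = -σ (d z) := fun z => by rw [hσd, neg_neg]
      have h1 := s.homotopy z
      have h3 := congrArg σ (s.homotopy (σ z))
      rw [map_add, map_smul, map_sub, hσσ, hσ, hσσ, hdσ, map_neg, map_neg] at h3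
      simp only [LinearMap.sub_apply, LinearMap.comp_apply, map_sub, hdσ]
      rw [two_mul, add_smul]
      nth_rewrite 1 [← h1]
      rw [← h3]
      abel
    · simp only [LinearMap.sub_apply, LinearMap.comp_apply, map_sub, hσσ]
      abel

/-- The tensor product of two splittings, for the differential `d ⊗ 1 + σ ⊗ d'`. -/
def tensor [IsDomain R] {d σ : M →ₗ[R] M} {d' : N →ₗ[R] N} (s : HomologySplitting d)
    (t : HomologySplitting d')
    (hσσ : ∀ z, σ (σ z) = z) (hσd : ∀ z, σ (d z) = -d (σ z))
    (hσ : ∀ z, σ (s.p z • s.x) = s.p (σ z) • s.x) (hσh : ∀ z, σ (s.h z) = -s.h (σ z)) :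
    HomologySplitting (TensorProduct.map d LinearMap.id + TensorProduct.map σ d') where
  x := s.x ⊗ₜ t.x
  p := LinearMap.mul' R R ∘ₗ TensorProduct.map s.p t.p
  -- First contract the left factor to the line spanned by `s.x`, then the right factor. The `σ`
  -- after `s.p` cancels the one in `σ ⊗ d'`; the cross terms `(σ h + h σ) ⊗ d'` vanish by
  -- anticommutation.
  h := t.a • TensorProduct.map s.h LinearMap.id +
    s.a • TensorProduct.map ((s.p ∘ₗ σ).smulRight s.x) t.h
  a := s.a * t.a
  diff_x := by simp [s.diff_x, t.diff_x]
  p_diff z := by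
    induction z using TensorProduct.induction_on with
    | zero => simp
    | tmul y z => simp [s.p_diff, t.p_diff]
    | add y z hy hz => rw [map_add, map_add, hy, hz, add_zero]
  p_x := by simp [s.p_x, t.p_x]
  a_ne_zero := mul_ne_zero s.a_ne_zero t.a_ne_zero
  homotopy z := by
    induction z using TensorProduct.induction_on with
    | zero => simp
    | tmul y z =>
      have h1 := congrArg (fun m => m ⊗ₜ[R] z) (s.homotopy y)
      have h2 := congrArg (fun m => (s.p y • s.x) ⊗ₜ[R] m) (t.homotopy z)
      have h3 : s.p (d (σ y)) = 0 := s.p_diff _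
      simp only [TensorProduct.add_tmul, TensorProduct.tmul_add] at h1 h2
      simp only [LinearMap.add_apply, LinearMap.smul_apply, TensorProduct.map_tmul, map_add,
        map_smul, LinearMap.id_apply, LinearMap.smulRight_apply, LinearMap.comp_apply, s.diff_x,
        smul_zero, TensorProduct.zero_tmul, hσd, map_neg, h3, hσσ, neg_zero, zero_smul, hσh,
        TensorProduct.neg_tmul, LinearMap.mul'_apply, mul_smul, zero_add]
      rw [← map_smul σ, hσ, hσσ]
      -- Telescoping: `1 - P ⊗ P' = (1 - P) ⊗ 1 + P ⊗ (1 - P')` for the projections `P = p(-) x` and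
      -- `P' = p'(-) x'`.
      have h4 : (s.a • t.a) • (y ⊗ₜ[R] z - s.p y • t.p z • s.x ⊗ₜ[R] t.x) =
          t.a • ((s.a • (y - s.p y • s.x)) ⊗ₜ[R] z) +
            s.a • ((s.p y • s.x) ⊗ₜ[R] (t.a • (z - t.p z • t.x))) := by
        simp only [TensorProduct.tmul_smul, TensorProduct.tmul_sub, ← TensorProduct.smul_tmul',
          TensorProduct.sub_tmul, smul_sub, smul_smul, smul_eq_mul]
        module
      rw [smul_eq_mul, mul_smul] at h4
      rw [h4, ← h1, ← h2]
      simp only [smul_add, smul_neg]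
      abel
    | add y z hy hz =>
      simp only [map_add, add_smul, smul_add, smul_sub] at hy hz ⊢
      rw [← sub_eq_zero] at hy hz ⊢
      rw [← add_zero (0 : M ⊗[R] N)]
      nth_rewrite 1 [← hy]
      rw [← hz]
      abel

/-- The dual of a splitting, for the transpose of the differential `d σ`. -/
def dual {d σ : M →ₗ[R] M} (s : HomologySplitting d)
    (hσσ : ∀ z, σ (σ z) = z) (hσd : ∀ z, σ (d z) = -d (σ z))
    (hσ : ∀ z, σ (s.p z • s.x) = s.p (σ z) • s.x) (hσh : ∀ z, σ (s.h z) = -s.h (σ z)) :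
    HomologySplitting (d ∘ₗ σ).dualMap where
  x := s.p
  p := Module.Dual.eval R M s.x
  -- The homotopy identity becomes the transpose of `σ h d σ + d σ σ h`, which equals `h d + d h`
  -- because `σ h d σ = h d`.
  h := (σ ∘ₗ s.h).dualMap
  a := s.a
  diff_x := LinearMap.ext fun z => by simp [s.p_diff]
  p_diff z := by
    have h1 := hσ s.x
    rw [s.p_x, one_smul] at h1
    have h2 : d (σ s.x) = 0 := by rw [h1, map_smul, s.diff_x, smul_zero]
    rw [Module.Dual.eval_apply, LinearMap.dualMap_apply, LinearMap.comp_apply, h2, map_zero]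
  p_x := by simp [s.p_x]
  a_ne_zero := s.a_ne_zero
  homotopy φ := LinearMap.ext fun z => by
    have h1 : σ (s.h (d (σ z))) = s.h (d z) := by
      rw [hσh, hσd, map_neg, neg_neg, hσσ]
    have h2 := congrArg φ (s.homotopy z)
    simp only [map_add, map_smul, map_sub] at h2
    simp only [LinearMap.add_apply, LinearMap.dualMap_apply, LinearMap.comp_apply, hσσ, h1,
      LinearMap.smul_apply, LinearMap.sub_apply, Module.Dual.eval_apply, smul_eq_mul] at h2 ⊢
    rw [add_comm, h2]
    ring

end HomologySplitting

namespace SComplex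

variable {G : GridData.{u}}

/-! ## Base change of complexes to a graded valuation ring -/

/-- A graded valuation ring that is a graded algebra over the grid ring. -/
structure IsGradedValuationAlgebra {R : Type u} [CommRing R] [Algebra G.S R]
    (𝒜 : ℤ × ℤ → AddSubgroup R) [GradedRing 𝒜] : Prop extends IsGradedValuationRing 𝒜 where
  algebraMap_mem : ∀ d, ∀ s ∈ G.gr d, algebraMap G.S R s ∈ 𝒜 d

theorem isGradedValuationAlgebra_grU : IsGradedValuationAlgebra (G := G) G.grU :=
  ⟨G.typeZeroU.toIsGradedValuationRing, fun _ _ hs => (G.mem_gr.1 hs).1⟩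

theorem isGradedValuationAlgebra_grV : IsGradedValuationAlgebra (G := G) G.grV :=
  ⟨G.typeZeroV.toIsGradedValuationRing, fun _ _ hs => (G.mem_gr.1 hs).2⟩

instance (C : SComplex G) : Module.Free G.S C.carrier := by
  obtain ⟨ι, _, b, -⟩ := C.exists_basis
  exact Module.Free.of_basis b

instance (C : SComplex G) : Module.Finite G.S C.carrier := by
  obtain ⟨ι, _, b, -⟩ := C.exists_basis
  exact Module.Finite.of_basis b

variable {R : Type u} [CommRing R] [Algebra G.S R] {𝒜 : ℤ × ℤ → AddSubgroup R}

theorem tmul_mem_baseGr (C : SComplex G) {i j n : ℤ × ℤ} {r : R} {x : C.carrier}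
    (hr : r ∈ 𝒜 i) (hx : x ∈ C.gr j) (h : i + j = n) : r ⊗ₜ[G.S] x ∈ C.baseGr 𝒜 n :=
  AddSubgroup.subset_closure ⟨i, j, r, x, hr, hx, h, rfl⟩

theorem map_mem_baseGr {C D : SComplex G} (f : C.carrier →ₗ[G.S] D.carrier) {w : ℤ × ℤ}
    (hf : ∀ n, ∀ x ∈ C.gr n, f x ∈ D.gr (n + w)) {n : ℤ × ℤ} {z : R ⊗[G.S] C.carrier}
    (hz : z ∈ C.baseGr 𝒜 n) : f.baseChange R z ∈ D.baseGr 𝒜 (n + w) := by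
  induction hz using AddSubgroup.closure_induction with
  | mem z hz =>
    obtain ⟨i, j, r, x, hr, hx, rfl, rfl⟩ := hz
    rw [LinearMap.baseChange_tmul]
    exact D.tmul_mem_baseGr hr (hf _ _ hx) (add_assoc _ _ _).symm
  | zero => rw [map_zero]; exact AddSubgroup.zero_mem _
  | add x y _ _ hx hy => rw [map_add]; exact AddSubgroup.add_mem _ hx hy
  | neg x _ hx => rw [map_neg]; exact AddSubgroup.neg_mem _ hx

variable [GradedRing 𝒜]

theorem one_tmul_mem_baseGr (C : SComplex G) {n : ℤ × ℤ} {x : C.carrier} (hx : x ∈ C.gr n) :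
    (1 : R) ⊗ₜ[G.S] x ∈ C.baseGr 𝒜 n :=
  C.tmul_mem_baseGr SetLike.GradedOne.one_mem hx (zero_add n)

/-- Turns the grading defined by generators into the coordinate form that elimination works with. -/
theorem mem_baseGr_iff_repr (h𝒜 : IsGradedValuationAlgebra (G := G) 𝒜) (C : SComplex G)
    {ι : Type} [Fintype ι] (b : Module.Basis ι G.S C.carrier) (δ : ι → ℤ × ℤ)
    (hb : ∀ d x, x ∈ C.gr d ↔ ∀ i, b.repr x i ∈ G.gr (d - δ i)) (n : ℤ × ℤ)
    (z : R ⊗[G.S] C.carrier) :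
    z ∈ C.baseGr 𝒜 n ↔ ∀ i, (b.baseChange R).repr z i ∈ 𝒜 (n - δ i) := by
  constructor
  · intro hz k
    induction hz using AddSubgroup.closure_induction with
    | mem z hz =>
      obtain ⟨i, j, r, x, hr, hx, rfl, rfl⟩ := hz
      rw [Module.Basis.baseChange_repr_tmul, Algebra.smul_def, mul_comm, add_sub_assoc]
      exact SetLike.GradedMul.mul_mem hr (h𝒜.algebraMap_mem _ _ ((hb j x).1 hx k))
    | zero => simp
    | add x y _ _ hx hy => rw [map_add, Finsupp.add_apply]; exact AddSubgroup.add_mem _ hx hy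
    | neg x _ hx => rw [map_neg, Finsupp.neg_apply]; exact AddSubgroup.neg_mem _ hx
  · intro h
    rw [← (b.baseChange R).sum_repr z]
    refine AddSubgroup.sum_mem _ fun i _ => ?_
    rw [Module.Basis.baseChange_apply, TensorProduct.smul_tmul', smul_eq_mul, mul_one]
    exact C.tmul_mem_baseGr (h i) (basis_mem_of_repr C.gr b δ hb i) (sub_add_cancel _ _)

theorem baseDiff_baseDiff (C : SComplex G) (z : R ⊗[G.S] C.carrier) :
    C.baseDiff R (C.baseDiff R z) = 0 := by
  induction z using TensorProduct.induction_on with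
  | zero => simp
  | tmul r x => simp [C.diff_diff]
  | add x y hx hy => rw [map_add, map_add, hx, hy, add_zero]

/-- The sign operator on the base change of a complex. -/
def baseSign (C : SComplex G) (R : Type u) [CommRing R] [Algebra G.S R] :
    R ⊗[G.S] C.carrier →ₗ[R] R ⊗[G.S] C.carrier :=
  C.sign.baseChange R

theorem baseSign_tmul (C : SComplex G) (r : R) (x : C.carrier) :
    C.baseSign R (r ⊗ₜ x) = r ⊗ₜ C.sign x := rfl

theorem baseSign_baseSign (C : SComplex G) (z : R ⊗[G.S] C.carrier) :
    C.baseSign R (C.baseSign R z) = z := by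
  induction z using TensorProduct.induction_on with
  | zero => simp
  | tmul r x => simp [baseSign_tmul, C.sign_sign]
  | add x y hx hy => rw [map_add, map_add, hx, hy]

theorem baseSign_baseDiff (C : SComplex G) (z : R ⊗[G.S] C.carrier) :
    C.baseSign R (C.baseDiff R z) = -C.baseDiff R (C.baseSign R z) := by
  induction z using TensorProduct.induction_on with
  | zero => simp
  | tmul r x => simp [baseSign_tmul, C.sign_diff, TensorProduct.tmul_neg]
  | add x y hx hy => simp only [map_add, hx, hy, neg_add]

/-- `σ` only sees the degree of the factor in `C`, but the sign of the scalar factor is invisible,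
so the total degree gives the same answer. -/
theorem baseSign_of_mem (h𝒜 : IsGradedDomain 𝒜) (C : SComplex G) {n : ℤ × ℤ}
    {z : R ⊗[G.S] C.carrier} (hz : z ∈ C.baseGr 𝒜 n) :
    C.baseSign R z = (n.1.negOnePow : ℤ) • z := by
  induction hz using AddSubgroup.closure_induction with
  | mem z hz =>
    obtain ⟨i, j, r, x, hr, hx, rfl, rfl⟩ := hz
    rw [baseSign_tmul, C.sign_of_mem hx, Prod.fst_add, Int.negOnePow_add, Units.val_mul, mul_comm,
      SemigroupAction.mul_smul, TensorProduct.smul_tmul', h𝒜.negOnePow_smul hr,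
      TensorProduct.tmul_smul]
  | zero => simp
  | add x y _ _ hx hy => rw [map_add, hx, hy, smul_add]
  | neg x _ hx => rw [map_neg, hx, smul_neg]

theorem baseSign_of_two_eq_zero (C : SComplex G) (h2 : (2 : R) = 0) (z : R ⊗[G.S] C.carrier) :
    C.baseSign R z = z := by
  have hneg : ∀ z : R ⊗[G.S] C.carrier, -z = z := fun z => by
    rw [neg_eq_iff_add_eq_zero, ← two_smul R, h2, zero_smul]
  induction z using TensorProduct.induction_on with
  | zero => simp
  | tmul r x =>
    rw [baseSign_tmul]
    induction x using DirectSum.Decomposition.inductionOn C.gr with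
    | zero => simp
    | @homogeneous d x =>
      rw [C.sign_of_mem x.2]
      rcases Int.even_or_odd d.1 with hd | hd
      · rw [Int.negOnePow_even _ hd]; simp
      · rw [Int.negOnePow_odd _ hd]; simp [TensorProduct.tmul_neg, hneg]
    | add x y hx hy => simp only [map_add, TensorProduct.tmul_add, hx, hy]
  | add x y hx hy => rw [map_add, hx, hy]

/-! ### Graded splittings and the tower conditions -/

/-- A splitting of the homology of `C ⊗ R` modulo torsion with homogeneous cycle and cocycle. -/
structure GradedSplitting (C : SComplex G) {R : Type u} [CommRing R] [Algebra G.S R]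
    (𝒜 : ℤ × ℤ → AddSubgroup R) (w : ℤ × ℤ) extends HomologySplitting (C.baseDiff R) where
  x_mem : x ∈ C.baseGr 𝒜 (-w)
  p_mem : ∀ n, ∀ z ∈ C.baseGr 𝒜 n, p z ∈ 𝒜 (n + w)

/-- The homology of `C ⊗ R` modulo torsion is isomorphic to `R`, up to a shift of degrees. -/
def IsTower (C : SComplex G) {R : Type u} [CommRing R] [Algebra G.S R]
    (𝒜 : ℤ × ℤ → AddSubgroup R) (w : ℤ × ℤ) : Prop :=
  ∃ φ : HomologyModTorsion (C.baseDiff R) ≃ₗ[R] R,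
    ∀ (n : ℤ × ℤ) (z : LinearMap.ker (C.baseDiff R)),
      (z : R ⊗[G.S] C.carrier) ∈ C.baseGr 𝒜 n → φ (HomologyModTorsion.mk _ z) ∈ 𝒜 (n + w)

/-- The left and right conditions are one condition with the shift confined to a coordinate axis;
axes are closed under sums and negatives, which serves tensor products and duals. -/
theorem isLeftKnotlike_iff (C : SComplex G) :
    C.IsLeftKnotlike ↔ ∃ k : ℤ, C.IsTower G.grU (k, 0) :=
  exists_comm

theorem isRightKnotlike_iff (C : SComplex G) :
    C.IsRightKnotlike ↔ ∃ k : ℤ, C.IsTower G.grV (0, k) :=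
  exists_comm

theorem GradedSplitting.isTower (h𝒜 : IsGradedDomain 𝒜) {C : SComplex G} {w : ℤ × ℤ}
    (s : C.GradedSplitting 𝒜 w) : C.IsTower 𝒜 w :=
  haveI := h𝒜.isDomain
  ⟨s.equiv, fun n z hz => s.p_mem n z hz⟩

theorem IsTower.nonempty_gradedSplitting (h𝒜 : IsGradedValuationAlgebra (G := G) 𝒜)
    {C : SComplex G} {w : ℤ × ℤ} (hC : C.IsTower 𝒜 w) : Nonempty (C.GradedSplitting 𝒜 w) := by
  have := h𝒜.isDomain
  obtain ⟨φ, hφ⟩ := hC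
  obtain ⟨ι, _, b, δ, hb, -⟩ := C.exists_repr
  have hgr := C.mem_baseGr_iff_repr h𝒜 b δ hb
  obtain ⟨π, hπgr, hπ, hid⟩ := exists_graded_retraction h𝒜.toIsGradedValuationRing hgr
    (C.baseDiff R) (-(1, 1)) fun n z hz => C.map_mem_baseGr (D := C) C.diff C.diff_mem hz
  obtain ⟨y, hy⟩ := φ.surjective 1
  obtain ⟨y, rfl⟩ := HomologyModTorsion.mk_surjective _ y
  let p : R ⊗[G.S] C.carrier →ₗ[R] R :=
    φ.toLinearMap ∘ₗ HomologyModTorsion.mk _ ∘ₗ π.codRestrict _ hπ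
  have hp : ∀ n, ∀ z ∈ C.baseGr 𝒜 n, p z ∈ 𝒜 (n + w) := fun n z hz => hφ n _ (hπgr n z hz)
  have hpy : p y = 1 := by
    rw [← hy]
    change φ (HomologyModTorsion.mk _ _) = _
    congr 2
    exact Subtype.ext (hid _ y.2)
  obtain ⟨x, hx, hpx⟩ := exists_homogeneous_of_apply_eq_one hgr p w hp hpy
  -- The homogeneous `x` need not be a cycle, but `π x` is a homogeneous cycle, and `p x = 1` says
  -- precisely that `φ` sends its class to `1`.
  obtain ⟨s, hs, hsp⟩ := HomologySplitting.exists_of_equiv (b.baseChange R) C.baseDiff_baseDiff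
    π hπ hid φ (π x) (hπ x) hpx
  refine ⟨⟨s, by rw [hs]; exact hπgr _ _ hx, fun n z hz => ?_⟩⟩
  rw [hsp]
  exact hp n z hz

theorem isTower_iff (h𝒜 : IsGradedValuationAlgebra (G := G) 𝒜) {C : SComplex G} {w : ℤ × ℤ} :
    C.IsTower 𝒜 w ↔ Nonempty (C.GradedSplitting 𝒜 w) :=
  ⟨fun h => h.nonempty_gradedSplitting h𝒜, fun ⟨s⟩ => s.isTower h𝒜.toIsGradedDomain⟩

namespace GradedSplitting

variable {C D : SComplex G} {w w' : ℤ × ℤ}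

/-- For `c` of degree `d`, `p (1 ⊗ c)` lies in degree `d + w`, where the sign of the total degree
acts trivially; so the sign of `d` may be traded for that of `w`. -/
theorem p_baseSign (h𝒜 : IsGradedValuationAlgebra (G := G) 𝒜) (s : C.GradedSplitting 𝒜 w)
    (z : R ⊗[G.S] C.carrier) : s.p (C.baseSign R z) = (w.1.negOnePow : ℤ) • s.p z := by
  induction z using TensorProduct.induction_on with
  | zero => simp
  | tmul r c =>
    induction c using DirectSum.Decomposition.inductionOn C.gr with
    | zero => simp
    | @homogeneous d c =>
      have h1 : r ⊗ₜ[G.S] (c : C.carrier) = r • ((1 : R) ⊗ₜ[G.S] (c : C.carrier)) := by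
        rw [TensorProduct.smul_tmul', smul_eq_mul, mul_one]
      have hc : (1 : R) ⊗ₜ[G.S] (c : C.carrier) ∈ C.baseGr 𝒜 d := C.one_tmul_mem_baseGr c.2
      have h2 := h𝒜.toIsGradedDomain.negOnePow_smul (s.p_mem _ _ hc)
      rw [Prod.fst_add, Int.negOnePow_add, Units.val_mul, mul_comm, SemigroupAction.mul_smul] at h2
      rw [h1, map_smul, map_smul, map_smul, C.baseSign_of_mem h𝒜.toIsGradedDomain hc, map_zsmul,
        ← smul_comm r]
      congr 1
      nth_rewrite 2 [← h2]
      rw [smul_comm, smul_smul (w.1.negOnePow : ℤ), ← Units.val_mul, Int.units_mul_self,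
        Units.val_one, one_smul]
    | add x y hx hy => simp only [map_add, TensorProduct.tmul_add, hx, hy, smul_add]
  | add x y hx hy => simp only [map_add, hx, hy, smul_add]

/-- `p` and `x` have opposite degrees and pick up the same sign under `σ`, so the projection `p(-)
x` commutes with `σ`, even though `p` or `x` alone may change sign. -/
theorem baseSign_smul_x (h𝒜 : IsGradedValuationAlgebra (G := G) 𝒜) (s : C.GradedSplitting 𝒜 w)
    (z : R ⊗[G.S] C.carrier) : C.baseSign R (s.p z • s.x) = s.p (C.baseSign R z) • s.x := by
  rw [map_smul, C.baseSign_of_mem h𝒜.toIsGradedDomain s.x_mem, s.p_baseSign h𝒜, Prod.fst_neg,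
    Int.negOnePow_neg, smul_comm, ← Int.cast_smul_eq_zsmul R, smul_smul,
    ← Int.cast_smul_eq_zsmul R, smul_eq_mul]

/-- The homotopy of a graded splitting can be chosen to anticommute with the sign operator. -/
theorem exists_anticomm (h𝒜 : IsGradedValuationAlgebra (G := G) 𝒜) (s : C.GradedSplitting 𝒜 w) :
    ∃ t : C.GradedSplitting 𝒜 w, t.x = s.x ∧ t.p = s.p ∧
      ∀ z, C.baseSign R (t.h z) = -t.h (C.baseSign R z) := by
  have := h𝒜.isDomain
  obtain ⟨t, hx, hp, ht⟩ := s.toHomologySplitting.exists_anticomm (C.baseSign R)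
    C.baseSign_baseSign C.baseSign_baseDiff (s.baseSign_smul_x h𝒜) C.baseSign_of_two_eq_zero
  exact ⟨⟨t, hx ▸ s.x_mem, hp ▸ s.p_mem⟩, hx, hp, ht⟩

/-- A chain map induces an isomorphism on homology modulo torsion if and only if its coefficient
with respect to splittings is invertible. -/
theorem bijective_iff (h𝒜 : IsGradedDomain 𝒜) (s : C.GradedSplitting 𝒜 w)
    (t : D.GradedSplitting 𝒜 w') (f : ChainMap C D) :
    Function.Bijective (f.homologyModTorsionMap R) ↔
      IsUnit (t.p (f.toLinearMap.baseChange R s.x)) :=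
  haveI := h𝒜.isDomain
  s.toHomologySplitting.bijective_map_iff t.toHomologySplitting _ _

end GradedSplitting

/-! ### The trivial complex -/

/-- The underlying module of the trivial complex. -/
def trivialEquiv (G : GridData.{u}) : (trivial G).carrier ≃ₗ[G.S] G.S :=
  LinearEquiv.refl G.S G.S

theorem mem_trivial_gr {n : ℤ × ℤ} {x : (trivial G).carrier} :
    x ∈ (trivial G).gr n ↔ trivialEquiv G x ∈ G.gr n := Iff.rfl

theorem trivialEquiv_symm_mem {n : ℤ × ℤ} {x : G.S} (hx : x ∈ G.gr n) :
    (trivialEquiv G).symm x ∈ (trivial G).gr n := hx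

theorem trivial_diff (x : (trivial G).carrier) : (trivial G).diff x = 0 := rfl

/-- The base change of the trivial complex. -/
def trivialBaseEquiv (R : Type u) [CommRing R] [Algebra G.S R] :
    R ⊗[G.S] (trivial G).carrier ≃ₗ[R] R :=
  (trivialEquiv G).baseChange G.S R _ _ ≪≫ₗ TensorProduct.AlgebraTensorModule.rid G.S R R

theorem trivialBaseEquiv_tmul (r : R) (s : (trivial G).carrier) :
    trivialBaseEquiv R (r ⊗ₜ[G.S] s) = algebraMap G.S R (trivialEquiv G s) * r := by
  rw [← Algebra.smul_def]
  rfl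

theorem trivialBaseEquiv_symm_one :
    (trivialBaseEquiv R).symm 1 = 1 ⊗ₜ[G.S] (trivialEquiv G).symm 1 := by
  rw [LinearEquiv.symm_apply_eq, trivialBaseEquiv_tmul, LinearEquiv.apply_symm_apply, map_one,
    mul_one]

/-- The trivial complex splits. -/
def trivialSplitting (h𝒜 : IsGradedValuationAlgebra (G := G) 𝒜) :
    (trivial G).GradedSplitting 𝒜 0 where
  x := (trivialBaseEquiv R).symm 1
  p := (trivialBaseEquiv R).toLinearMap
  h := 0
  a := 1
  diff_x := LinearMap.congr_fun LinearMap.baseChange_zero _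
  p_diff z := by
    have h1 : (trivial G).baseDiff R z = 0 := LinearMap.congr_fun LinearMap.baseChange_zero z
    rw [h1, map_zero]
  p_x := (trivialBaseEquiv R).apply_symm_apply 1
  a_ne_zero :=
    haveI := h𝒜.isDomain
    one_ne_zero
  homotopy z := by
    have h1 : (trivial G).baseDiff R = 0 := LinearMap.baseChange_zero
    rw [h1, one_smul, ← map_smul, smul_eq_mul, mul_one]
    simp
  x_mem := by
    rw [neg_zero, trivialBaseEquiv_symm_one]
    exact (trivial G).one_tmul_mem_baseGr (trivialEquiv_symm_mem SetLike.GradedOne.one_mem)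
  p_mem n z hz := by
    rw [add_zero]
    induction hz using AddSubgroup.closure_induction with
    | mem z hz =>
      obtain ⟨i, j, r, x, hr, hx, rfl, rfl⟩ := hz
      rw [LinearEquiv.coe_coe, trivialBaseEquiv_tmul, mul_comm]
      exact SetLike.GradedMul.mul_mem hr (h𝒜.algebraMap_mem _ _ hx)
    | zero => rw [map_zero]; exact AddSubgroup.zero_mem _
    | add x y _ _ hx hy => rw [map_add]; exact AddSubgroup.add_mem _ hx hy
    | neg x _ hx => rw [map_neg]; exact AddSubgroup.neg_mem _ hx

end SComplex

namespace SComplex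

variable {G : GridData.{u}}

/-! ### Tensor products of complexes -/

/-- The underlying module of a tensor product of complexes. -/
def tensorEquiv (C D : SComplex G) : (C.tensor D).carrier ≃ₗ[G.S] C.carrier ⊗[G.S] D.carrier :=
  LinearEquiv.refl G.S _

/-- The element `x ⊗ y` of a tensor product of complexes. -/
def tmul {C D : SComplex G} (x : C.carrier) (y : D.carrier) : (C.tensor D).carrier :=
  (C.tensorEquiv D).symm (x ⊗ₜ y)

section TensorElements

variable {C D : SComplex G}

theorem tensorEquiv_symm_tmul (x : C.carrier) (y : D.carrier) :
    (C.tensorEquiv D).symm (x ⊗ₜ y) = tmul x y := rfl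

theorem tmul_add (x : C.carrier) (y y' : D.carrier) : tmul x (y + y') = tmul x y + tmul x y' :=
  TensorProduct.tmul_add x y y'

theorem add_tmul (x x' : C.carrier) (y : D.carrier) : tmul (x + x') y = tmul x y + tmul x' y :=
  TensorProduct.add_tmul x x' y

@[simp] theorem tmul_zero (x : C.carrier) : tmul x (0 : D.carrier) = 0 :=
  TensorProduct.tmul_zero _ x

@[simp] theorem zero_tmul (y : D.carrier) : tmul (0 : C.carrier) y = 0 :=
  TensorProduct.zero_tmul _ y

theorem tmul_zsmul (n : ℤ) (x : C.carrier) (y : D.carrier) : tmul x (n • y) = n • tmul x y :=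
  map_zsmul (((C.tensorEquiv D).symm.toLinearMap ∘ₗ TensorProduct.mk G.S _ _ x).toAddMonoidHom) n y

theorem zsmul_tmul (n : ℤ) (x : C.carrier) (y : D.carrier) : tmul (n • x) y = n • tmul x y :=
  map_zsmul (((C.tensorEquiv D).symm.toLinearMap ∘ₗ
    (TensorProduct.mk G.S _ _).flip y).toAddMonoidHom) n x

theorem tensor_diff_tmul (x : C.carrier) (y : D.carrier) :
    (C.tensor D).diff (tmul x y) = tmul (C.diff x) y + tmul (C.sign x) (D.diff y) := rfl

theorem tmul_mem {i j n : ℤ × ℤ} {x : C.carrier} {y : D.carrier} (hx : x ∈ C.gr i)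
    (hy : y ∈ D.gr j) (h : i + j = n) : tmul x y ∈ (C.tensor D).gr n :=
  C.tmul_mem_tensorGr D hx hy h

theorem tensor_induction {motive : (C.tensor D).carrier → Prop} (z : (C.tensor D).carrier)
    (zero : motive 0) (tmul : ∀ x y, motive (tmul x y))
    (add : ∀ y z, motive y → motive z → motive (y + z)) : motive z :=
  TensorProduct.induction_on (motive := motive) z zero tmul add

/-- Induction over homogeneous pure tensors. -/
theorem tensor_homogeneous_induction {motive : (C.tensor D).carrier → Prop}
    (z : (C.tensor D).carrier) (zero : motive 0)
    (tmul : ∀ (i j : ℤ × ℤ) (x : C.carrier) (y : D.carrier), x ∈ C.gr i → y ∈ D.gr j →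
      motive (tmul x y))
    (add : ∀ y z, motive y → motive z → motive (y + z)) : motive z := by
  induction z using tensor_induction with
  | zero => exact zero
  | tmul x y =>
    induction x using DirectSum.Decomposition.inductionOn C.gr with
    | zero => simpa using zero
    | @homogeneous i x =>
      induction y using DirectSum.Decomposition.inductionOn D.gr with
      | zero => simpa using zero
      | @homogeneous j y => exact tmul i j x y x.2 y.2
      | add y y' hy hy' => rw [tmul_add]; exact add _ _ hy hy'
    | add x x' hx hx' => rw [add_tmul]; exact add _ _ hx hx'
  | add y z hy hz => exact add _ _ hy hz

/-- A property of homogeneous elements of a tensor product can be checked on pure tensors. -/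
theorem tensor_apply_mem {N : Type u} [AddCommGroup N] (F : (C.tensor D).carrier →+ N)
    (H : AddSubgroup N) (n : ℤ × ℤ)
    (h : ∀ i j x y, x ∈ C.gr i → y ∈ D.gr j → i + j = n → F (tmul x y) ∈ H)
    {z : (C.tensor D).carrier} (hz : z ∈ (C.tensor D).gr n) : F z ∈ H := by
  have hle : (C.tensor D).gr n ≤ H.comap F := by
    refine (AddSubgroup.closure_le _).2 ?_
    rintro z ⟨i, j, x, y, hx, hy, hij, rfl⟩
    exact h i j x y hx hy hij
  exact hle hz

variable {R : Type u} [CommRing R] [Algebra G.S R] {𝒜 : ℤ × ℤ → AddSubgroup R}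

theorem baseGr_apply_mem {N : Type u} [AddCommGroup N] (F : R ⊗[G.S] C.carrier →+ N)
    (H : AddSubgroup N) (n : ℤ × ℤ)
    (h : ∀ i j r x, r ∈ 𝒜 i → x ∈ C.gr j → i + j = n → F (r ⊗ₜ x) ∈ H)
    {z : R ⊗[G.S] C.carrier} (hz : z ∈ C.baseGr 𝒜 n) : F z ∈ H := by
  have hle : C.baseGr 𝒜 n ≤ H.comap F := by
    refine (AddSubgroup.closure_le _).2 ?_
    rintro z ⟨i, j, r, x, hr, hx, hij, rfl⟩
    exact h i j r x hr hx hij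
  exact hle hz

theorem tensor_baseGr_apply_mem {N : Type u} [AddCommGroup N]
    (F : R ⊗[G.S] (C.tensor D).carrier →+ N) (H : AddSubgroup N) (n : ℤ × ℤ)
    (h : ∀ k i j r x y, r ∈ 𝒜 k → x ∈ C.gr i → y ∈ D.gr j → k + (i + j) = n →
      F (r ⊗ₜ tmul x y) ∈ H)
    {z : R ⊗[G.S] (C.tensor D).carrier} (hz : z ∈ (C.tensor D).baseGr 𝒜 n) : F z ∈ H := by
  refine baseGr_apply_mem F H n (fun k m r z hr hz hkm => ?_) hz
  refine tensor_apply_mem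
    (F.comp ((TensorProduct.mk G.S R (C.tensor D).carrier r).toAddMonoidHom)) H m
    (fun i j x y hx hy hij => ?_) hz
  exact h k i j r x y hr hx hy (by rw [hij, hkm])

/-- The base change of a tensor product of complexes. -/
def tensorBaseEquiv (C D : SComplex G) (R : Type u) [CommRing R] [Algebra G.S R] :
    R ⊗[G.S] (C.tensor D).carrier ≃ₗ[R] (R ⊗[G.S] C.carrier) ⊗[R] (R ⊗[G.S] D.carrier) :=
  (C.tensorEquiv D).baseChange G.S R _ _ ≪≫ₗ
    TensorProduct.AlgebraTensorModule.distribBaseChange G.S R C.carrier D.carrier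

theorem tensorBaseEquiv_tmul (r : R) (x : C.carrier) (y : D.carrier) :
    C.tensorBaseEquiv D R (r ⊗ₜ tmul x y) = (r ⊗ₜ x) ⊗ₜ (1 ⊗ₜ y) := rfl

theorem tensorBaseEquiv_symm_tmul (r r' : R) (x : C.carrier) (y : D.carrier) :
    (C.tensorBaseEquiv D R).symm ((r ⊗ₜ x) ⊗ₜ (r' ⊗ₜ y)) = (r * r') ⊗ₜ tmul x y := by
  rw [LinearEquiv.symm_apply_eq, tensorBaseEquiv_tmul]
  have h1 : r' ⊗ₜ[G.S] y = r' • ((1 : R) ⊗ₜ[G.S] y) := by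
    rw [TensorProduct.smul_tmul', smul_eq_mul, mul_one]
  rw [h1, ← TensorProduct.smul_tmul, TensorProduct.smul_tmul', smul_eq_mul, mul_comm]

/-- Base change of the tensor differential has the form `d ⊗ 1 + σ ⊗ d'` treated by
`HomologySplitting.tensor`. -/
theorem tensorBaseEquiv_baseDiff (z : R ⊗[G.S] (C.tensor D).carrier) :
    C.tensorBaseEquiv D R ((C.tensor D).baseDiff R z) =
      (TensorProduct.map (C.baseDiff R) LinearMap.id +
        TensorProduct.map (C.baseSign R) (D.baseDiff R) :
        (R ⊗[G.S] C.carrier) ⊗[R] (R ⊗[G.S] D.carrier) →ₗ[R] _) (C.tensorBaseEquiv D R z) := by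
  induction z using TensorProduct.induction_on with
  | zero => simp
  | tmul r z =>
    induction z using tensor_induction with
    | zero => simp
    | tmul x y =>
      rw [LinearMap.baseChange_tmul, tensor_diff_tmul, TensorProduct.tmul_add, map_add,
        tensorBaseEquiv_tmul, tensorBaseEquiv_tmul, tensorBaseEquiv_tmul]
      rfl
    | add y z hy hz => simp only [TensorProduct.tmul_add, map_add, hy, hz]
  | add y z hy hz => simp only [map_add, hy, hz]

end TensorElements

namespace GradedSplitting

variable {C D : SComplex G} {R : Type u} [CommRing R] [Algebra G.S R]
  {𝒜 : ℤ × ℤ → AddSubgroup R} [GradedRing 𝒜] {w w' : ℤ × ℤ}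

/-- The tensor product of graded splittings. -/
theorem exists_tensor (h𝒜 : IsGradedValuationAlgebra (G := G) 𝒜) (s : C.GradedSplitting 𝒜 w)
    (t : D.GradedSplitting 𝒜 w') :
    ∃ v : (C.tensor D).GradedSplitting 𝒜 (w + w'),
      v.x = (C.tensorBaseEquiv D R).symm (s.x ⊗ₜ t.x) ∧
      ∀ r x y, v.p (r ⊗ₜ tmul x y) = s.p (r ⊗ₜ x) * t.p (1 ⊗ₜ y) := by
  have := h𝒜.isDomain
  -- Only the left factor meets the sign operator, so only its homotopy has to anticommute; its `x`
  -- and `p` are kept.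
  obtain ⟨s', hx, hp, hs'⟩ := s.exists_anticomm h𝒜
  rw [← hx, ← hp]
  clear hx hp
  let v := (s'.toHomologySplitting.tensor t.toHomologySplitting C.baseSign_baseSign
    C.baseSign_baseDiff (s'.baseSign_smul_x h𝒜) hs').congr (C.tensorBaseEquiv D R).symm
    (d' := (C.tensor D).baseDiff R) (fun z => by
      rw [LinearEquiv.symm_apply_eq, tensorBaseEquiv_baseDiff, LinearEquiv.apply_symm_apply])
  have hv : ∀ r x y, v.p (r ⊗ₜ tmul x y) = s'.p (r ⊗ₜ x) * t.p (1 ⊗ₜ y) := fun r x y => rfl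
  refine ⟨⟨v, ?_, fun n z hz => ?_⟩, rfl, hv⟩
  · change (C.tensorBaseEquiv D R).symm (s'.x ⊗ₜ t.x) ∈ (C.tensor D).baseGr 𝒜 (-(w + w'))
    refine baseGr_apply_mem ((C.tensorBaseEquiv D R).symm.toLinearMap ∘ₗ
      (TensorProduct.mk R _ _).flip t.x).toAddMonoidHom _ _ (fun i j r x hr hx hij => ?_) s'.x_mem
    refine baseGr_apply_mem ((C.tensorBaseEquiv D R).symm.toLinearMap ∘ₗ
      TensorProduct.mk R _ _ (r ⊗ₜ x)).toAddMonoidHom _ _ (fun k l r' y hr' hy hkl => ?_) t.x_mem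
    change (C.tensorBaseEquiv D R).symm ((r ⊗ₜ x) ⊗ₜ (r' ⊗ₜ y)) ∈ _
    rw [tensorBaseEquiv_symm_tmul]
    refine (C.tensor D).tmul_mem_baseGr (SetLike.GradedMul.mul_mem hr hr') (tmul_mem hx hy rfl) ?_
    rw [neg_add, ← hij, ← hkl]
    abel
  · refine tensor_baseGr_apply_mem v.p.toAddMonoidHom _ n (fun k i j r x y hr hx hy h => ?_) hz
    change v.p (r ⊗ₜ tmul x y) ∈ 𝒜 (n + (w + w'))
    rw [hv]
    have h1 := SetLike.GradedMul.mul_mem (s'.p_mem _ _ (C.tmul_mem_baseGr hr hx rfl))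
      (t.p_mem _ _ (D.one_tmul_mem_baseGr hy))
    have h2 : k + i + w + (j + w') = n + (w + w') := by rw [← h]; abel
    rwa [h2] at h1

end GradedSplitting

/-! ### Dual complexes -/

/-- The underlying module of the dual complex. -/
def dualEquiv (C : SComplex G) : C.dual.carrier ≃ₗ[G.S] Module.Dual G.S C.carrier :=
  LinearEquiv.refl G.S _

/-- The sign `-(-1) ^ |φ|` can be moved to the argument as `(-1) ^ |x|`: the value `φ (∂ x)` has
degree `|x| - 1 + |φ|`, and the sign of that degree fixes it. Thus the dual differential is the
transpose of `∂ σ`, which survives base change. -/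
theorem dualEquiv_diff (C : SComplex G) (φ : C.dual.carrier) (x : C.carrier) :
    C.dualEquiv (C.dual.diff φ) x = C.dualEquiv φ (C.diff (C.sign x)) := by
  induction φ using DirectSum.Decomposition.inductionOn C.dual.gr with
  | zero => simp
  | @homogeneous n φ =>
    induction x using DirectSum.Decomposition.inductionOn C.gr with
    | zero => simp
    | @homogeneous m x =>
      have h1 : C.dualEquiv (C.dual.diff φ) =
          -((n.1.negOnePow : ℤ) • (C.dualEquiv φ ∘ₗ C.diff)) := C.dualDiff_of_mem φ.2
      have h2 : C.dualEquiv φ (C.diff x) ∈ G.gr (m - (1, 1) + n) := φ.2 _ _ (C.diff_mem _ _ x.2)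
      have h3 := G.negOnePow_smul h2
      rw [h1, C.sign_of_mem x.2, map_zsmul, map_zsmul]
      rw [Prod.fst_add, Prod.fst_sub, Int.negOnePow_add, Int.negOnePow_sub, Units.val_mul,
        Units.val_mul, mul_assoc, SemigroupAction.mul_smul] at h3
      simp only [LinearMap.neg_apply, LinearMap.smul_apply, LinearMap.comp_apply]
      nth_rewrite 2 [← h3]
      rw [smul_smul, ← Units.val_mul, Int.units_mul_self, Units.val_one, one_smul]
      simp
    | add x y hx hy => simp only [map_add, hx, hy]
  | add φ ψ hφ hψ => simp only [map_add, LinearMap.add_apply, hφ, hψ]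

theorem mem_dual_gr {C : SComplex G} {n : ℤ × ℤ} {φ : C.dual.carrier} :
    φ ∈ C.dual.gr n ↔ ∀ d, ∀ x ∈ C.gr d, C.dualEquiv φ x ∈ G.gr (d + n) := Iff.rfl

section DualBase

variable {R : Type u} [CommRing R] [Algebra G.S R]

/-- The base change of a dual complex. -/
def dualBaseEquiv (C : SComplex G) (R : Type u) [CommRing R] [Algebra G.S R] :
    R ⊗[G.S] C.dual.carrier ≃ₗ[R] Module.Dual R (R ⊗[G.S] C.carrier) :=
  C.dualEquiv.baseChange G.S R _ _ ≪≫ₗ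
    (TensorProduct.isBaseChange G.S C.carrier R).toDualBaseChange

theorem dualBaseEquiv_tmul_tmul (C : SComplex G) (r r' : R) (φ : C.dual.carrier) (x : C.carrier) :
    C.dualBaseEquiv R (r ⊗ₜ φ) (r' ⊗ₜ x) = r * r' * algebraMap G.S R (C.dualEquiv φ x) := by
  have h1 : r' ⊗ₜ[G.S] x = r' • ((1 : R) ⊗ₜ[G.S] x) := by
    rw [TensorProduct.smul_tmul', smul_eq_mul, mul_one]
  have h2 : C.dualBaseEquiv R (r ⊗ₜ φ) (1 ⊗ₜ x) = r * algebraMap G.S R (C.dualEquiv φ x) :=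
    (TensorProduct.isBaseChange G.S C.carrier R).toDualBaseChange_tmul r (C.dualEquiv φ) x
  rw [h1, map_smul, h2, smul_eq_mul]
  ring

theorem dualBaseEquiv_baseDiff (C : SComplex G) (z : R ⊗[G.S] C.dual.carrier) :
    C.dualBaseEquiv R (C.dual.baseDiff R z) =
      (C.baseDiff R ∘ₗ C.baseSign R).dualMap (C.dualBaseEquiv R z) := by
  refine LinearMap.ext fun y => ?_
  rw [LinearMap.dualMap_apply, LinearMap.comp_apply]
  induction z using TensorProduct.induction_on with
  | zero => simp
  | tmul r φ =>
    induction y using TensorProduct.induction_on with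
    | zero => simp
    | tmul r' x =>
      rw [LinearMap.baseChange_tmul, dualBaseEquiv_tmul_tmul, baseSign_tmul,
        LinearMap.baseChange_tmul, dualBaseEquiv_tmul_tmul, dualEquiv_diff]
    | add x y hx hy => simp only [map_add, hx, hy]
  | add z z' hz hz' => simp only [map_add, LinearMap.add_apply, hz, hz']

/-- Dual basis expansion, from which the degree of the transported cocycle can be read. -/
theorem dualBaseEquiv_symm (C : SComplex G) {ι : Type} [Fintype ι]
    (b : Module.Basis ι G.S C.carrier) (p : Module.Dual R (R ⊗[G.S] C.carrier)) :
    (C.dualBaseEquiv R).symm p = ∑ i, p (1 ⊗ₜ b i) ⊗ₜ[G.S] C.dualEquiv.symm (b.coord i) := by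
  classical
  rw [LinearEquiv.symm_apply_eq, map_sum]
  refine (b.baseChange R).ext fun j => ?_
  rw [Module.Basis.baseChange_apply, LinearMap.sum_apply]
  simp [dualBaseEquiv_tmul_tmul, Finsupp.single_apply, apply_ite (algebraMap G.S R)]

end DualBase

namespace GradedSplitting

variable {C : SComplex G} {R : Type u} [CommRing R] [Algebra G.S R]
  {𝒜 : ℤ × ℤ → AddSubgroup R} [GradedRing 𝒜] {w : ℤ × ℤ}

/-- The dual of a graded splitting. -/
theorem exists_dual (h𝒜 : IsGradedValuationAlgebra (G := G) 𝒜) (s : C.GradedSplitting 𝒜 w) :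
    ∃ v : C.dual.GradedSplitting 𝒜 (-w), v.x = (C.dualBaseEquiv R).symm s.p ∧
      ∀ z, v.p z = C.dualBaseEquiv R z s.x := by
  have := h𝒜.isDomain
  obtain ⟨s', hx, hp, hs'⟩ := s.exists_anticomm h𝒜
  rw [← hx, ← hp]
  clear hx hp
  let v := (s'.toHomologySplitting.dual C.baseSign_baseSign
    C.baseSign_baseDiff (s'.baseSign_smul_x h𝒜) hs').congr (C.dualBaseEquiv R).symm
    (d' := C.dual.baseDiff R) (fun z => by
      rw [LinearEquiv.symm_apply_eq, dualBaseEquiv_baseDiff, LinearEquiv.apply_symm_apply])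
  have hv : ∀ z, v.p z = C.dualBaseEquiv R z s'.x := fun z => rfl
  refine ⟨⟨v, ?_, fun n z hz => ?_⟩, rfl, hv⟩
  · change (C.dualBaseEquiv R).symm s'.p ∈ _
    obtain ⟨ι, _, b, δ, hb, -⟩ := C.exists_repr
    -- Each summand pairs the scalar `p (1 ⊗ b i)` of degree `δ i + w` with a dual basis vector of
    -- degree `-δ i`.
    rw [C.dualBaseEquiv_symm b, neg_neg]
    refine AddSubgroup.sum_mem _ fun i _ => ?_
    refine C.dual.tmul_mem_baseGr (i := δ i + w) (j := -δ i)
      (s'.p_mem _ _ (C.one_tmul_mem_baseGr (basis_mem_of_repr C.gr b δ hb i))) ?_ (by abel)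
    rw [mem_dual_gr]
    intro d x hx
    rw [LinearEquiv.apply_symm_apply, ← sub_eq_add_neg]
    exact (hb d x).1 hx i
  · refine baseGr_apply_mem v.p.toAddMonoidHom _ n (fun i j r φ hr hφ hij => ?_) hz
    change C.dualBaseEquiv R (r ⊗ₜ φ) s'.x ∈ _
    refine baseGr_apply_mem (C.dualBaseEquiv R (r ⊗ₜ φ)).toAddMonoidHom _ (-w)
      (fun k l r' x hr' hx hkl => ?_) s'.x_mem
    change C.dualBaseEquiv R (r ⊗ₜ φ) (r' ⊗ₜ x) ∈ _
    rw [dualBaseEquiv_tmul_tmul]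
    have h1 := SetLike.GradedMul.mul_mem (SetLike.GradedMul.mul_mem hr hr')
      (h𝒜.algebraMap_mem _ _ (hφ l x hx))
    have h2 : i + k + (l + j) = n + -w := by rw [← hij, ← hkl]; abel
    rwa [h2] at h1

end GradedSplitting

/-! ### Knotlike complexes -/

theorem isReduced_trivial (G : GridData.{u}) : (trivial G).IsReduced := fun x => by
  rw [trivial_diff]
  exact Submodule.zero_mem _

/-- Each Leibniz term is the image of `∂ x` or `∂ y` under a linear map, and linear maps respect
multiples of the ideal. -/
theorem IsReduced.tensor {C D : SComplex G} (hC : C.IsReduced) (hD : D.IsReduced) :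
    (C.tensor D).IsReduced := by
  intro z
  induction z using tensor_induction with
  | zero => rw [map_zero]; exact Submodule.zero_mem _
  | tmul x y =>
    rw [tensor_diff_tmul]
    refine Submodule.add_mem _ ?_ ?_
    · have h1 := Submodule.mem_map_of_mem (f := (C.tensorEquiv D).symm.toLinearMap ∘ₗ
        (TensorProduct.mk G.S _ _).flip y) (hC x)
      rw [Submodule.map_smul''] at h1
      exact Submodule.smul_mono le_rfl le_top h1
    · have h1 := Submodule.mem_map_of_mem (f := (C.tensorEquiv D).symm.toLinearMap ∘ₗ
        TensorProduct.mk G.S _ _ (C.sign x)) (hD y)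
      rw [Submodule.map_smul''] at h1
      exact Submodule.smul_mono le_rfl le_top h1
  | add y z hy hz => rw [map_add]; exact Submodule.add_mem _ hy hz

/-- In the dual basis the coefficients of `∂^∨ φ` are the values `φ (∂ σ b_i)`, which lie in the
ideal. -/
theorem IsReduced.dual {C : SComplex G} (hC : C.IsReduced) : C.dual.IsReduced := by
  intro φ
  obtain ⟨ι, _, b, -⟩ := C.exists_basis
  have h1 : C.dual.diff φ = ∑ i, C.dualEquiv φ (C.diff (C.sign (b i))) •
      C.dualEquiv.symm (b.coord i) := by
    classical
    apply C.dualEquiv.injective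
    refine b.ext fun j => ?_
    rw [dualEquiv_diff, map_sum, LinearMap.sum_apply]
    simp [Finsupp.single_apply]
  rw [h1]
  refine Submodule.sum_mem _ fun i _ => Submodule.smul_mem_smul ?_ Submodule.mem_top
  have h2 := Submodule.mem_map_of_mem (f := C.dualEquiv φ) (hC (C.sign (b i)))
  rw [Submodule.map_smul''] at h2
  have h3 := Submodule.smul_mono (le_refl (G.mU ⊔ G.mV)) (le_top :
    Submodule.map (C.dualEquiv φ) ⊤ ≤ ⊤) h2
  rwa [smul_eq_mul, Ideal.mul_top] at h3

theorem isKnotlike_trivial (G : GridData.{u}) : (trivial G).IsKnotlike where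
  left := (isLeftKnotlike_iff _).2
    ⟨0, (isTower_iff isGradedValuationAlgebra_grU).2 ⟨trivialSplitting isGradedValuationAlgebra_grU⟩⟩
  right := (isRightKnotlike_iff _).2
    ⟨0, (isTower_iff isGradedValuationAlgebra_grV).2 ⟨trivialSplitting isGradedValuationAlgebra_grV⟩⟩
  reduced := isReduced_trivial G

theorem IsTower.tensor {R : Type u} [CommRing R] [Algebra G.S R] {𝒜 : ℤ × ℤ → AddSubgroup R}
    [GradedRing 𝒜] (h𝒜 : IsGradedValuationAlgebra (G := G) 𝒜) {C D : SComplex G} {w w' : ℤ × ℤ}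
    (hC : C.IsTower 𝒜 w) (hD : D.IsTower 𝒜 w') : (C.tensor D).IsTower 𝒜 (w + w') := by
  obtain ⟨s⟩ := hC.nonempty_gradedSplitting h𝒜
  obtain ⟨t⟩ := hD.nonempty_gradedSplitting h𝒜
  obtain ⟨v, -⟩ := s.exists_tensor h𝒜 t
  exact v.isTower h𝒜.toIsGradedDomain

theorem IsTower.dual {R : Type u} [CommRing R] [Algebra G.S R] {𝒜 : ℤ × ℤ → AddSubgroup R}
    [GradedRing 𝒜] (h𝒜 : IsGradedValuationAlgebra (G := G) 𝒜) {C : SComplex G} {w : ℤ × ℤ}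
    (hC : C.IsTower 𝒜 w) : C.dual.IsTower 𝒜 (-w) := by
  obtain ⟨s⟩ := hC.nonempty_gradedSplitting h𝒜
  obtain ⟨v, -⟩ := s.exists_dual h𝒜
  exact v.isTower h𝒜.toIsGradedDomain

/-- The tensor product of knotlike complexes is knotlike. -/
theorem IsKnotlike.tensor {C D : SComplex G} (hC : C.IsKnotlike) (hD : D.IsKnotlike) :
    (C.tensor D).IsKnotlike where
  left := by
    obtain ⟨k, hk⟩ := (isLeftKnotlike_iff _).1 hC.left
    obtain ⟨l, hl⟩ := (isLeftKnotlike_iff _).1 hD.left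
    refine (isLeftKnotlike_iff _).2 ⟨k + l, ?_⟩
    simpa using hk.tensor isGradedValuationAlgebra_grU hl
  right := by
    obtain ⟨k, hk⟩ := (isRightKnotlike_iff _).1 hC.right
    obtain ⟨l, hl⟩ := (isRightKnotlike_iff _).1 hD.right
    refine (isRightKnotlike_iff _).2 ⟨k + l, ?_⟩
    simpa using hk.tensor isGradedValuationAlgebra_grV hl
  reduced := hC.reduced.tensor hD.reduced

/-- The dual of a knotlike complex is knotlike. -/
theorem IsKnotlike.dual {C : SComplex G} (hC : C.IsKnotlike) : C.dual.IsKnotlike where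
  left := by
    obtain ⟨k, hk⟩ := (isLeftKnotlike_iff _).1 hC.left
    refine (isLeftKnotlike_iff _).2 ⟨-k, ?_⟩
    simpa using hk.dual isGradedValuationAlgebra_grU
  right := by
    obtain ⟨k, hk⟩ := (isRightKnotlike_iff _).1 hC.right
    refine (isRightKnotlike_iff _).2 ⟨-k, ?_⟩
    simpa using hk.dual isGradedValuationAlgebra_grV
  reduced := hC.reduced.dual

end SComplex

namespace SComplex

variable {G : GridData.{u}}

/-! ### Local maps in terms of splittings -/

theorem IsKnotlike.exists_gradedSplitting {C : SComplex G} (hC : C.IsKnotlike) :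
    ∃ k : ℤ, Nonempty (C.GradedSplitting G.grV (0, k)) := by
  obtain ⟨k, hk⟩ := (isRightKnotlike_iff _).1 hC.right
  exact ⟨k, hk.nonempty_gradedSplitting isGradedValuationAlgebra_grV⟩

/-- The working criterion: once degrees are checked, locality is invertibility of one scalar,
computed with any convenient splittings. -/
theorem GradedSplitting.isLocal_iff {C D : SComplex G} {w w' : ℤ × ℤ}
    (s : C.GradedSplitting G.grV w) (t : D.GradedSplitting G.grV w') (f : ChainMap C D) :
    f.IsLocal ↔ (∃ k : ℤ, ∀ n : ℤ × ℤ, ∀ x ∈ C.gr n, f.toLinearMap x ∈ D.gr (n + (0, k))) ∧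
      IsUnit (t.p (f.toLinearMap.baseChange G.RV s.x)) := by
  rw [← s.bijective_iff isGradedValuationAlgebra_grV.toIsGradedDomain t f]
  exact ⟨fun h => ⟨h.1, h.2⟩, fun h => ⟨h.1, h.2⟩⟩

/-! ### Tensor products of local maps -/

/-- The sign depends only on the first degree, which `f` preserves. This is why `f ⊗ g` and the
transpose of `f` are chain maps without extra signs. -/
theorem ChainMap.map_sign {C D : SComplex G} (f : ChainMap C D) {k : ℤ}
    (hf : ∀ n : ℤ × ℤ, ∀ x ∈ C.gr n, f.toLinearMap x ∈ D.gr (n + (0, k))) (x : C.carrier) :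
    f.toLinearMap (C.sign x) = D.sign (f.toLinearMap x) := by
  induction x using DirectSum.Decomposition.inductionOn C.gr with
  | zero => simp
  | @homogeneous d x =>
    rw [C.sign_of_mem x.2, D.sign_of_mem (hf d _ x.2), map_zsmul, Prod.fst_add, add_zero]
  | add x y hx hy => simp only [map_add, hx, hy]

/-- The tensor product of linear maps between complexes. -/
def tensorMap {C C' D D' : SComplex G} (f : C.carrier →ₗ[G.S] C'.carrier)
    (g : D.carrier →ₗ[G.S] D'.carrier) : (C.tensor D).carrier →ₗ[G.S] (C'.tensor D').carrier :=
  (C'.tensorEquiv D').symm.toLinearMap ∘ₗ TensorProduct.map f g ∘ₗ (C.tensorEquiv D).toLinearMap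

theorem tensorMap_tmul {C C' D D' : SComplex G} (f : C.carrier →ₗ[G.S] C'.carrier)
    (g : D.carrier →ₗ[G.S] D'.carrier) (x : C.carrier) (y : D.carrier) :
    tensorMap f g (tmul x y) = tmul (f x) (g y) := rfl

/-- The tensor product of two local maps. -/
def ChainMap.IsLocal.tensorChainMap {C C' D D' : SComplex G} {f : ChainMap C C'}
    (hf : f.IsLocal) (g : ChainMap D D') : ChainMap (C.tensor D) (C'.tensor D') where
  toLinearMap := tensorMap f.toLinearMap g.toLinearMap
  comm z := by
    obtain ⟨k, hk⟩ := hf.degree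
    induction z using tensor_induction with
    | zero => simp
    | tmul x y =>
      rw [tensor_diff_tmul, map_add, tensorMap_tmul, tensorMap_tmul, tensorMap_tmul,
        tensor_diff_tmul, f.comm, g.comm, f.map_sign hk]
    | add y z hy hz => simp only [map_add, hy, hz]

/-- With tensor product splittings, the scalar of `f ⊗ g` is the product of the scalars of `f` and
`g`. -/
theorem ChainMap.IsLocal.tensor {C C' D D' : SComplex G} (hC : C.IsKnotlike)
    (hC' : C'.IsKnotlike) (hD : D.IsKnotlike) (hD' : D'.IsKnotlike) {f : ChainMap C C'}
    {g : ChainMap D D'} (hf : f.IsLocal) (hg : g.IsLocal) : (hf.tensorChainMap g).IsLocal := by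
  obtain ⟨a, ⟨s⟩⟩ := hC.exists_gradedSplitting
  obtain ⟨a', ⟨s'⟩⟩ := hC'.exists_gradedSplitting
  obtain ⟨b, ⟨t⟩⟩ := hD.exists_gradedSplitting
  obtain ⟨b', ⟨t'⟩⟩ := hD'.exists_gradedSplitting
  obtain ⟨⟨k, hk⟩, hfu⟩ := (s.isLocal_iff s' f).1 hf
  obtain ⟨⟨l, hl⟩, hgu⟩ := (t.isLocal_iff t' g).1 hg
  obtain ⟨v, hv, -⟩ := s.exists_tensor isGradedValuationAlgebra_grV t
  obtain ⟨v', -, hv'⟩ := s'.exists_tensor isGradedValuationAlgebra_grV t'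
  refine (v.isLocal_iff v' _).2 ⟨⟨k + l, fun n z hz => ?_⟩, ?_⟩
  · refine tensor_apply_mem (tensorMap f.toLinearMap g.toLinearMap).toAddMonoidHom _ n
      (fun i j x y hx hy hij => ?_) hz
    change tensorMap f.toLinearMap g.toLinearMap (tmul x y) ∈ _
    rw [tensorMap_tmul]
    refine tmul_mem (hk i x hx) (hl j y hy) ?_
    rw [← hij]
    ext <;> simp [add_assoc, add_left_comm]
  · have key : ∀ x y, v'.p ((tensorMap f.toLinearMap g.toLinearMap).baseChange G.RV
        ((C.tensorBaseEquiv D G.RV).symm (x ⊗ₜ y))) =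
        s'.p (f.toLinearMap.baseChange G.RV x) * t'.p (g.toLinearMap.baseChange G.RV y) := by
      intro x y
      induction x using TensorProduct.induction_on with
      | zero => simp
      | tmul r x =>
        induction y using TensorProduct.induction_on with
        | zero => simp
        | tmul r' y =>
          have h1 : ∀ r : G.RV, ∀ x : D'.carrier, r ⊗ₜ[G.S] x = r • ((1 : G.RV) ⊗ₜ[G.S] x) :=
            fun r x => by rw [TensorProduct.smul_tmul', smul_eq_mul, mul_one]
          have h2 : ∀ r : G.RV, ∀ x : C'.carrier, r ⊗ₜ[G.S] x = r • ((1 : G.RV) ⊗ₜ[G.S] x) :=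
            fun r x => by rw [TensorProduct.smul_tmul', smul_eq_mul, mul_one]
          rw [tensorBaseEquiv_symm_tmul, LinearMap.baseChange_tmul, tensorMap_tmul, hv',
            LinearMap.baseChange_tmul, LinearMap.baseChange_tmul, h1 r', h2 (r * r'), h2 r,
            map_smul, map_smul, map_smul, smul_eq_mul, smul_eq_mul, smul_eq_mul]
          ring
        | add y z hy hz => simp only [TensorProduct.tmul_add, map_add, hy, hz, mul_add]
      | add x z hx hz => simp only [TensorProduct.add_tmul, map_add, hx, hz, add_mul]
    rw [hv]
    exact (key s.x t.x) ▸ hfu.mul hgu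

/-! ### Duals of local maps -/

/-- The transpose of a linear map between complexes. -/
def dualMap {C D : SComplex G} (f : C.carrier →ₗ[G.S] D.carrier) :
    D.dual.carrier →ₗ[G.S] C.dual.carrier :=
  C.dualEquiv.symm.toLinearMap ∘ₗ f.dualMap ∘ₗ D.dualEquiv.toLinearMap

theorem dualEquiv_dualMap {C D : SComplex G} (f : C.carrier →ₗ[G.S] D.carrier)
    (φ : D.dual.carrier) (x : C.carrier) :
    C.dualEquiv (dualMap f φ) x = D.dualEquiv φ (f x) := rfl

/-- The dual of a local map. -/
def ChainMap.IsLocal.dualChainMap {C D : SComplex G} {f : ChainMap C D} (hf : f.IsLocal) :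
    ChainMap D.dual C.dual where
  toLinearMap := dualMap f.toLinearMap
  comm φ := by
    obtain ⟨k, hk⟩ := hf.degree
    apply C.dualEquiv.injective
    refine LinearMap.ext fun x => ?_
    rw [dualEquiv_dualMap, dualEquiv_diff, dualEquiv_diff, dualEquiv_dualMap, f.comm,
      f.map_sign hk]

/-- With dual splittings, the scalar of the transpose is `(p' ∘ f) x`, the same scalar as for `f`.
-/
theorem ChainMap.IsLocal.dual {C D : SComplex G} (hC : C.IsKnotlike) (hD : D.IsKnotlike)
    {f : ChainMap C D} (hf : f.IsLocal) : hf.dualChainMap.IsLocal := by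
  obtain ⟨a, ⟨s⟩⟩ := hC.exists_gradedSplitting
  obtain ⟨b, ⟨t⟩⟩ := hD.exists_gradedSplitting
  obtain ⟨⟨k, hk⟩, hfu⟩ := (s.isLocal_iff t f).1 hf
  obtain ⟨s', -, hs'⟩ := s.exists_dual isGradedValuationAlgebra_grV
  obtain ⟨t', ht', -⟩ := t.exists_dual isGradedValuationAlgebra_grV
  refine (t'.isLocal_iff s' _).2 ⟨⟨k, fun n φ hφ => ?_⟩, ?_⟩
  · refine mem_dual_gr.2 fun d x hx => ?_
    change D.dualEquiv φ (f.toLinearMap x) ∈ _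
    have h1 := mem_dual_gr.1 hφ _ _ (hk d x hx)
    have h2 : d + (0, k) + n = d + (n + (0, k)) := by abel
    rwa [h2] at h1
  · have key : ∀ z x, C.dualBaseEquiv G.RV ((dualMap f.toLinearMap).baseChange G.RV z) x =
        D.dualBaseEquiv G.RV z (f.toLinearMap.baseChange G.RV x) := by
      intro z x
      induction z using TensorProduct.induction_on with
      | zero => simp
      | tmul r φ =>
        induction x using TensorProduct.induction_on with
        | zero => simp
        | tmul r' x =>
          rw [LinearMap.baseChange_tmul, LinearMap.baseChange_tmul, dualBaseEquiv_tmul_tmul,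
            dualBaseEquiv_tmul_tmul, dualEquiv_dualMap]
        | add x y hx hy => simp only [map_add, hx, hy]
      | add y z hy hz => simp only [map_add, LinearMap.add_apply, hy, hz]
    rw [hs', ht']
    have h1 := key ((D.dualBaseEquiv G.RV).symm t.p) s.x
    rw [LinearEquiv.apply_symm_apply] at h1
    exact h1 ▸ hfu

/-! ### Evaluation and coevaluation -/

/-- The evaluation map `x ⊗ φ ↦ (-1) ^ |x| φ x`. -/
def evalMap (C : SComplex G) : (C.tensor C.dual).carrier →ₗ[G.S] (trivial G).carrier :=
  (trivialEquiv G).symm.toLinearMap ∘ₗ contractRight G.S C.carrier ∘ₗ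
    TensorProduct.map C.sign C.dualEquiv.toLinearMap ∘ₗ (C.tensorEquiv C.dual).toLinearMap

theorem trivialEquiv_evalMap (C : SComplex G) (x : C.carrier) (φ : C.dual.carrier) :
    trivialEquiv G (C.evalMap (tmul x φ)) = C.dualEquiv φ (C.sign x) := rfl

/-- Evaluation as a chain map. -/
def eval (C : SComplex G) : ChainMap (C.tensor C.dual) (trivial G) where
  toLinearMap := C.evalMap
  comm z := by
    rw [trivial_diff]
    induction z using tensor_induction with
    | zero => simp
    | tmul x φ =>
      apply (trivialEquiv G).injective
      -- The Leibniz terms evaluate to `φ (σ ∂ x) = -φ (∂ σ x)` and to `(∂^∨ φ) (σ σ x) = φ (∂ σ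
      -- x)`.
      rw [tensor_diff_tmul, map_add, map_add, trivialEquiv_evalMap, trivialEquiv_evalMap,
        dualEquiv_diff, C.sign_sign, C.sign_diff, map_neg, neg_add_cancel, map_zero]
    | add y z hy hz => rw [map_add, map_add, hy, hz, add_zero]

/-- In the tensor of a splitting with its dual, the distinguished cycle is `x ⊗ p`; its evaluation
is `p (σ x)`, that is `p x = 1` up to sign. -/
theorem isLocal_eval {C : SComplex G} (hC : C.IsKnotlike) : C.eval.IsLocal := by
  obtain ⟨k, ⟨s⟩⟩ := hC.exists_gradedSplitting
  obtain ⟨s', hs', -⟩ := s.exists_dual isGradedValuationAlgebra_grV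
  obtain ⟨v, hv, -⟩ := s.exists_tensor isGradedValuationAlgebra_grV s'
  refine (v.isLocal_iff (trivialSplitting isGradedValuationAlgebra_grV) _).2
    ⟨⟨0, fun n z hz => ?_⟩, ?_⟩
  · refine tensor_apply_mem C.evalMap.toAddMonoidHom _ n (fun i j x φ hx hφ hij => ?_) hz
    refine mem_trivial_gr.2 ?_
    change C.dualEquiv φ (C.sign x) ∈ _
    have h1 := mem_dual_gr.1 hφ _ _ (C.sign_mem hx)
    rw [hij] at h1
    rwa [Prod.mk_zero_zero, add_zero]
  · have key : ∀ x z, trivialBaseEquiv G.RV (C.evalMap.baseChange G.RV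
        ((C.tensorBaseEquiv C.dual G.RV).symm (x ⊗ₜ z))) =
        C.dualBaseEquiv G.RV z (C.baseSign G.RV x) := by
      intro x z
      induction z using TensorProduct.induction_on with
      | zero => simp
      | tmul r φ =>
        induction x using TensorProduct.induction_on with
        | zero => simp
        | tmul r' x =>
          rw [tensorBaseEquiv_symm_tmul, LinearMap.baseChange_tmul, trivialBaseEquiv_tmul,
            baseSign_tmul, dualBaseEquiv_tmul_tmul, trivialEquiv_evalMap]
          ring
        | add x y hx hy => simp only [map_add, TensorProduct.add_tmul, hx, hy]
      | add y z hy hz => simp only [map_add, TensorProduct.tmul_add, LinearMap.add_apply, hy, hz]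
    have h1 := key s.x s'.x
    rw [hs', LinearEquiv.apply_symm_apply, s.p_baseSign isGradedValuationAlgebra_grV, s.p_x,
      ← hs', ← hv] at h1
    refine h1.symm ▸ ?_
    rw [← Int.cast_smul_eq_zsmul G.RV, smul_eq_mul, mul_one]
    exact (Units.isUnit ((0, k) : ℤ × ℤ).1.negOnePow).map (Int.castRingHom G.RV)

/-- Moving an endomorphism across the canonical element of `M ⊗ M*`. -/
theorem sum_apply_tmul_coord {A M : Type u} [CommRing A] [AddCommGroup M] [Module A M] {ι : Type}
    [Fintype ι] (b : Module.Basis ι A M) (g : M →ₗ[A] M) :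
    ∑ i, g (b i) ⊗ₜ[A] b.coord i = ∑ i, b i ⊗ₜ[A] (b.coord i ∘ₗ g) := by
  classical
  -- Expanding the transpose in the dual basis makes both sides the sum of matrix entries of `g`
  -- times `b i ⊗ b.coord j`.
  have h1 : ∀ i, b.coord i ∘ₗ g = ∑ j, b.repr (g (b j)) i • b.coord j := fun i => by
    refine b.ext fun k => ?_
    rw [LinearMap.sum_apply]
    simp [Finsupp.single_apply]
  simp only [h1, TensorProduct.tmul_sum]
  rw [Finset.sum_comm]
  refine Finset.sum_congr rfl fun j _ => ?_
  conv_lhs => rw [← b.sum_repr (g (b j)), TensorProduct.sum_tmul]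
  simp only [TensorProduct.smul_tmul]

/-- The coevaluation map is local. -/
theorem exists_isLocal_coeval {C : SComplex G} (hC : C.IsKnotlike) :
    ∃ f : ChainMap (trivial G) (C.tensor C.dual), f.IsLocal := by
  obtain ⟨ι, _, b, δ, hb, -⟩ := C.exists_repr
  let ω : (C.tensor C.dual).carrier := ∑ i, tmul (b i) (C.dualEquiv.symm (b.coord i))
  -- Moving `∂ σ` across the canonical element turns the second Leibniz sum into `∑ σ ∂ σ b_i ⊗
  -- b_i^* = -∑ ∂ b_i ⊗ b_i^*`, cancelling the first.
  have hω : (C.tensor C.dual).diff ω = 0 := by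
    have h1 : ∑ i, tmul (C.diff (b i)) (C.dualEquiv.symm (b.coord i)) =
        (C.tensorEquiv C.dual).symm (TensorProduct.map LinearMap.id C.dualEquiv.symm.toLinearMap
          (∑ i, C.diff (b i) ⊗ₜ b.coord i)) := by
      simp [tensorEquiv_symm_tmul]
    have h2 : ∑ i, tmul (C.sign (b i)) (C.dual.diff (C.dualEquiv.symm (b.coord i))) =
        (C.tensorEquiv C.dual).symm (TensorProduct.map C.sign C.dualEquiv.symm.toLinearMap
          (∑ i, b i ⊗ₜ (b.coord i ∘ₗ (C.diff ∘ₗ C.sign)))) := by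
      rw [map_sum, map_sum]
      refine Finset.sum_congr rfl fun i _ => ?_
      rw [TensorProduct.map_tmul, tensorEquiv_symm_tmul]
      congr 1
      apply C.dualEquiv.injective
      refine LinearMap.ext fun x => ?_
      rw [dualEquiv_diff, LinearEquiv.apply_symm_apply, LinearEquiv.coe_coe,
        LinearEquiv.apply_symm_apply]
      rfl
    rw [map_sum]
    simp only [tensor_diff_tmul]
    rw [Finset.sum_add_distrib, h1, h2, ← sum_apply_tmul_coord, ← map_add, map_sum, map_sum,
      ← Finset.sum_add_distrib, Finset.sum_eq_zero, map_zero]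
    intro i _
    simp only [TensorProduct.map_tmul, LinearMap.comp_apply, LinearMap.id_apply, C.sign_diff,
      C.sign_sign, TensorProduct.neg_tmul]
    exact add_neg_cancel _
  have hω0 : ω ∈ (C.tensor C.dual).gr 0 := by
    refine AddSubgroup.sum_mem _ fun i _ => tmul_mem (i := δ i) (j := -δ i)
      (basis_mem_of_repr C.gr b δ hb i) ?_ (add_neg_cancel _)
    refine mem_dual_gr.2 fun d x hx => ?_
    rw [LinearEquiv.apply_symm_apply, ← sub_eq_add_neg]
    exact (hb d x).1 hx i
  let f : ChainMap (trivial G) (C.tensor C.dual) :=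
    ⟨LinearMap.toSpanSingleton G.S _ ω ∘ₗ (trivialEquiv G).toLinearMap, fun x => by
      rw [trivial_diff, map_zero, LinearMap.comp_apply, LinearMap.toSpanSingleton_apply, map_smul,
        hω, smul_zero]⟩
  have hf : ∀ x, f.toLinearMap x = trivialEquiv G x • ω := fun x => rfl
  obtain ⟨k, ⟨s⟩⟩ := hC.exists_gradedSplitting
  obtain ⟨s', -, hs'⟩ := s.exists_dual isGradedValuationAlgebra_grV
  obtain ⟨v, -, hv⟩ := s.exists_tensor isGradedValuationAlgebra_grV s'
  refine ⟨f, ((trivialSplitting isGradedValuationAlgebra_grV).isLocal_iff v f).2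
    ⟨⟨0, fun n x hx => ?_⟩, ?_⟩⟩
  · rw [hf, Prod.mk_zero_zero]
    exact (C.tensor C.dual).smul_mem _ _ _ (mem_trivial_gr.1 hx) _ hω0
  · have h1 : (trivialSplitting (G := G) isGradedValuationAlgebra_grV).x =
        1 ⊗ₜ[G.S] (trivialEquiv G).symm 1 := trivialBaseEquiv_symm_one
    -- The scalar is `∑ p(b_i) b_i^*(x)`, the dual basis expansion of `p` evaluated at `x`, hence `p
    -- x`.
    have h2 : v.p (1 ⊗ₜ ω) = 1 := by
      have h3 := congrArg (fun z => C.dualBaseEquiv G.RV z s.x) (C.dualBaseEquiv_symm b s.p)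
      simp only [LinearEquiv.apply_symm_apply, map_sum, LinearMap.sum_apply] at h3
      rw [s.p_x] at h3
      rw [TensorProduct.tmul_sum, map_sum]
      refine Eq.trans ?_ h3.symm
      refine Finset.sum_congr rfl fun i _ => ?_
      have h4 : ∀ (r : G.RV) (φ : C.dual.carrier), r ⊗ₜ[G.S] φ = r • ((1 : G.RV) ⊗ₜ[G.S] φ) :=
        fun r x => by rw [TensorProduct.smul_tmul', smul_eq_mul, mul_one]
      rw [hv, hs', h4 (s.p _), map_smul, LinearMap.smul_apply, smul_eq_mul]
    rw [h1, LinearMap.baseChange_tmul, hf, LinearEquiv.apply_symm_apply, one_smul, h2]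
    exact isUnit_one

/-! ### Isomorphisms of complexes -/

theorem ChainMap.ext {C D : SComplex G} {f g : ChainMap C D}
    (h : ∀ x, f.toLinearMap x = g.toLinearMap x) : f = g := by
  cases f
  cases g
  congr 1
  exact LinearMap.ext h

/-- A degree-preserving isomorphism commutes with projection to homogeneous components, so its
inverse preserves degrees too. -/
theorem symm_mem_gr {C D : SComplex G} (e : C.carrier ≃ₗ[G.S] D.carrier)
    (he : ∀ n, ∀ x ∈ C.gr n, e x ∈ D.gr n) (n : ℤ × ℤ) (y : D.carrier) (hy : y ∈ D.gr n) :
    e.symm y ∈ C.gr n := by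
  have h1 : ∀ x, (DirectSum.decompose D.gr (e x) n : D.carrier) =
      e (DirectSum.decompose C.gr x n) := by
    intro x
    induction x using DirectSum.Decomposition.inductionOn C.gr with
    | zero => simp
    | @homogeneous d x =>
      by_cases h : d = n
      · subst h
        rw [DirectSum.decompose_of_mem_same _ (he d x x.2),
          DirectSum.decompose_of_mem_same _ x.2]
      · rw [DirectSum.decompose_of_mem_ne _ (he d x x.2) h,
          DirectSum.decompose_of_mem_ne _ x.2 h, map_zero]
    | add x y hx hy => simp [DirectSum.decompose_add, hx, hy]
  have h2 := h1 (e.symm y)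
  rw [LinearEquiv.apply_symm_apply, DirectSum.decompose_of_mem_same _ hy] at h2
  rw [h2, LinearEquiv.symm_apply_apply]
  exact SetLike.coe_mem _

theorem ChainMap.isLocal_of_inverse {C D : SComplex G} (f : ChainMap C D) (g : ChainMap D C)
    (hf : ∀ n, ∀ x ∈ C.gr n, f.toLinearMap x ∈ D.gr n)
    (hgf : g.comp f = ChainMap.id C) (hfg : f.comp g = ChainMap.id D) : f.IsLocal where
  degree := ⟨0, fun n x hx => by
    rw [Prod.mk_zero_zero, add_zero]
    exact hf n x hx⟩
  bijective := by
    refine Function.bijective_iff_has_inverse.2 ⟨g.homologyModTorsionMap G.RV, fun x => ?_,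
      fun x => ?_⟩
    · rw [← homologyModTorsionMap_comp, hgf, homologyModTorsionMap_id]
    · rw [← homologyModTorsionMap_comp, hfg, homologyModTorsionMap_id]

/-- Isomorphic complexes are locally equivalent. -/
theorem exists_isLocal_of_equiv {C D : SComplex G} (e : C.carrier ≃ₗ[G.S] D.carrier)
    (hd : ∀ x, e (C.diff x) = D.diff (e x)) (he : ∀ n, ∀ x ∈ C.gr n, e x ∈ D.gr n) :
    (∃ f : ChainMap C D, f.IsLocal) ∧ ∃ f : ChainMap D C, f.IsLocal := by
  let f : ChainMap C D := ⟨e.toLinearMap, hd⟩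
  let g : ChainMap D C := ⟨e.symm.toLinearMap, fun x => by
    rw [LinearEquiv.coe_coe, LinearEquiv.symm_apply_eq, hd, LinearEquiv.apply_symm_apply]⟩
  have hgf : g.comp f = ChainMap.id C := ChainMap.ext fun x => e.symm_apply_apply x
  have hfg : f.comp g = ChainMap.id D := ChainMap.ext fun x => e.apply_symm_apply x
  exact ⟨⟨f, f.isLocal_of_inverse g he hgf hfg⟩,
    ⟨g, g.isLocal_of_inverse f (symm_mem_gr e he) hfg hgf⟩⟩

/-! ### Associativity and unit of the tensor product -/

theorem tensor_sign_tmul {C D : SComplex G} (x : C.carrier) (y : D.carrier) :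
    (C.tensor D).sign (tmul x y) = tmul (C.sign x) (D.sign y) := by
  induction x using DirectSum.Decomposition.inductionOn C.gr with
  | zero => simp
  | @homogeneous i x =>
    induction y using DirectSum.Decomposition.inductionOn D.gr with
    | zero => simp
    | @homogeneous j y =>
      rw [(C.tensor D).sign_of_mem (tmul_mem x.2 y.2 rfl), C.sign_of_mem x.2, D.sign_of_mem y.2,
        tmul_zsmul, zsmul_tmul, smul_smul, Prod.fst_add, Int.negOnePow_add, Units.val_mul, mul_comm]
    | add y y' hy hy' => simp only [map_add, tmul_add, hy, hy']
  | add x x' hx hx' => simp only [map_add, add_tmul, hx, hx']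

/-- Associativity of the tensor product of complexes. -/
def tensorAssoc (C D E : SComplex G) :
    ((C.tensor D).tensor E).carrier ≃ₗ[G.S] (C.tensor (D.tensor E)).carrier :=
  TensorProduct.assoc G.S C.carrier D.carrier E.carrier

theorem tensorAssoc_tmul {C D E : SComplex G} (x : C.carrier) (y : D.carrier) (z : E.carrier) :
    tensorAssoc C D E (tmul (tmul x y) z) = tmul x (tmul y z) := rfl

theorem exists_isLocal_assoc (C D E : SComplex G) :
    (∃ f : ChainMap ((C.tensor D).tensor E) (C.tensor (D.tensor E)), f.IsLocal) ∧
      ∃ f : ChainMap (C.tensor (D.tensor E)) ((C.tensor D).tensor E), f.IsLocal := by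
  refine exists_isLocal_of_equiv (tensorAssoc C D E) (fun w => ?_) fun n w hw => ?_
  · induction w using tensor_induction with
    | zero => simp
    | tmul v z =>
      induction v using tensor_induction with
      | zero => simp
      | tmul x y =>
        simp only [tensor_diff_tmul, tensor_sign_tmul, add_tmul, tmul_add, map_add,
          tensorAssoc_tmul, add_assoc]
      | add v v' hv hv' => simp only [add_tmul, map_add, hv, hv']
    | add v v' hv hv' => simp only [map_add, hv, hv']
  · refine tensor_apply_mem (tensorAssoc C D E).toLinearMap.toAddMonoidHom _ n
      (fun m l v z hv hz hml => ?_) hw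
    refine tensor_apply_mem (C := C) (D := D) ((tensorAssoc C D E).toLinearMap.toAddMonoidHom.comp
      ((((C.tensor D).tensorEquiv E).symm.toLinearMap ∘ₗ
        (TensorProduct.mk G.S _ _).flip z).toAddMonoidHom)) _ m (fun i j x y hx hy hij => ?_) hv
    change tensorAssoc C D E (tmul (tmul x y) z) ∈ _
    rw [tensorAssoc_tmul]
    exact tmul_mem hx (tmul_mem hy hz rfl) (by rw [← hml, ← hij, add_assoc])

/-- The unit isomorphism of the tensor product of complexes. -/
def tensorTrivial (C : SComplex G) : (C.tensor (trivial G)).carrier ≃ₗ[G.S] C.carrier :=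
  TensorProduct.rid G.S C.carrier

theorem tensorTrivial_tmul {C : SComplex G} (x : C.carrier) (s : (trivial G).carrier) :
    C.tensorTrivial (tmul x s) = trivialEquiv G s • x := rfl

theorem exists_isLocal_tensor_trivial (C : SComplex G) :
    (∃ f : ChainMap (C.tensor (trivial G)) C, f.IsLocal) ∧
      ∃ f : ChainMap C (C.tensor (trivial G)), f.IsLocal := by
  refine exists_isLocal_of_equiv C.tensorTrivial (fun z => ?_) fun n z hz => ?_
  · induction z using tensor_induction with
    | zero => simp
    | tmul x s =>
      rw [tensor_diff_tmul, trivial_diff, tmul_zero, add_zero, tensorTrivial_tmul,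
        tensorTrivial_tmul, map_smul]
    | add y z hy hz => simp only [map_add, hy, hz]
  · refine tensor_apply_mem C.tensorTrivial.toLinearMap.toAddMonoidHom _ n
      (fun i j x s hx hs hij => ?_) hz
    change C.tensorTrivial (tmul x s) ∈ _
    rw [tensorTrivial_tmul, ← hij, add_comm]
    exact C.smul_mem _ _ _ (mem_trivial_gr.1 hs) _ hx

/-! ### Commutativity -/

/-- The sign is `1` for even `m` and `(-1) ^ d.1` for odd `m`; both act trivially on degree `d`. -/
theorem negOnePow_mul_smul {d : ℤ × ℤ} {s : G.S} (hs : s ∈ G.gr d) (m : ℤ) :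
    ((m * d.1).negOnePow : ℤ) • s = s := by
  rcases Int.even_or_odd m with hm | hm
  · rw [Int.negOnePow_even _ (hm.mul_right _), Units.val_one, one_smul]
  · obtain ⟨l, rfl⟩ := hm
    have h1 : (2 * l + 1) * d.1 = 2 * (l * d.1) + d.1 := by ring
    rw [h1, Int.negOnePow_add, Int.negOnePow_two_mul, one_mul, G.negOnePow_smul hs]

/-- The swap map `x ⊗ y ↦ (-1) ^ (|x| |y|) y ⊗ x`. -/
theorem exists_swap (C D : SComplex G) :
    ∃ τ : (C.tensor D).carrier →ₗ[G.S] (D.tensor C).carrier,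
      ∀ i j x y, x ∈ C.gr i → y ∈ D.gr j →
        τ (tmul x y) = ((i.1 * j.1).negOnePow : ℤ) • tmul y x := by
  classical
  obtain ⟨ι, _, b, δ, hb, -⟩ := D.exists_repr
  -- A sign depending on both degrees must be made linear. On a basis vector `b k` of `D` it is the
  -- power `σ ^ (δ k).1` of the sign operator of `C`, and the swap is extended linearly from there.
  let σ : ι → C.carrier →ₗ[G.S] C.carrier := fun k =>
    if Even (δ k).1 then LinearMap.id else C.sign
  have hσ : ∀ k i x, x ∈ C.gr i → σ k x = ((i.1 * (δ k).1).negOnePow : ℤ) • x := by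
    intro k i x hx
    by_cases h : Even (δ k).1
    · simp [σ, h, Int.negOnePow_even _ (h.mul_left i.1)]
    · simp only [σ, h, if_false]
      rw [C.sign_of_mem hx]
      obtain ⟨l, hl⟩ := Int.not_even_iff_odd.1 h
      have h1 : i.1 * (δ k).1 = 2 * (i.1 * l) + i.1 := by rw [hl]; ring
      rw [h1, Int.negOnePow_add, Int.negOnePow_two_mul, one_mul]
  let L : D.carrier →ₗ[G.S] C.carrier →ₗ[G.S] (D.tensor C).carrier :=
    b.constr ℕ fun k => (D.tensorEquiv C).symm.toLinearMap ∘ₗ TensorProduct.mk G.S _ _ (b k) ∘ₗ σ k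
  have hL : ∀ y x, L y x = ∑ k, b.repr y k • tmul (b k) (σ k x) := by
    intro y x
    rw [Module.Basis.constr_apply_fintype, LinearMap.sum_apply]
    rfl
  refine ⟨TensorProduct.lift L.flip ∘ₗ (C.tensorEquiv D).toLinearMap, fun i j x y hx hy => ?_⟩
  change L y x = _
  have h1 : tmul y x = ∑ k, b.repr y k • tmul (b k) x := by
    conv_lhs => rw [← b.sum_repr y]
    simp only [tmul, TensorProduct.sum_tmul, map_sum, ← TensorProduct.smul_tmul', map_smul]
  rw [hL, h1, Finset.smul_sum]
  refine Finset.sum_congr rfl fun k _ => ?_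
  -- The `k`-th coordinate of `y` has degree `j - δ k`, so `(-1) ^ (i (j - δ k))` fixes it; this
  -- replaces the sign of `i * δ k` by that of `i * j`.
  have h2 := negOnePow_mul_smul ((hb j y).1 hy k) i.1
  rw [hσ k i x hx, tmul_zsmul, smul_comm]
  conv_lhs => rw [← h2]
  rw [← Int.cast_smul_eq_zsmul G.S (((i.1 * (j - δ k).1).negOnePow : ℤˣ) : ℤ), smul_assoc,
    Int.cast_smul_eq_zsmul, smul_smul, ← Units.val_mul, ← Int.negOnePow_add, Prod.fst_sub,
    mul_sub, add_sub_cancel]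

theorem exists_isLocal_comm (C D : SComplex G) :
    (∃ f : ChainMap (C.tensor D) (D.tensor C), f.IsLocal) ∧
      ∃ f : ChainMap (D.tensor C) (C.tensor D), f.IsLocal := by
  obtain ⟨τ, hτ⟩ := C.exists_swap D
  obtain ⟨τ', hτ'⟩ := D.exists_swap C
  have h1 : ∀ z, τ' (τ z) = z := fun z => by
    induction z using tensor_homogeneous_induction with
    | zero => simp
    | tmul i j x y hx hy =>
      rw [hτ i j x y hx hy, map_zsmul, hτ' j i y x hy hx, smul_smul, mul_comm j.1,
        ← Units.val_mul, Int.units_mul_self, Units.val_one, one_smul]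
    | add y z hy hz => simp only [map_add, hy, hz]
  have h2 : ∀ z, τ (τ' z) = z := fun z => by
    induction z using tensor_homogeneous_induction with
    | zero => simp
    | tmul i j x y hx hy =>
      rw [hτ' i j x y hx hy, map_zsmul, hτ j i y x hy hx, smul_smul, mul_comm j.1,
        ← Units.val_mul, Int.units_mul_self, Units.val_one, one_smul]
    | add y z hy hz => simp only [map_add, hy, hz]
  let e : (C.tensor D).carrier ≃ₗ[G.S] (D.tensor C).carrier :=
    LinearEquiv.ofLinearMap τ τ' (LinearMap.ext h2) (LinearMap.ext h1)
  have he : ∀ i j x y, x ∈ C.gr i → y ∈ D.gr j →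
      e (tmul x y) = ((i.1 * j.1).negOnePow : ℤ) • tmul y x := hτ
  refine exists_isLocal_of_equiv e (fun z => ?_) fun n z hz => ?_
  · induction z using tensor_homogeneous_induction with
    | zero => simp
    | tmul i j x y hx hy =>
      -- Matching coefficients uses `(-1) ^ ((i-1) j) = (-1) ^ (i j) (-1) ^ j` for `y ⊗ ∂ x` and
      -- `(-1) ^ i (-1) ^ (i (j-1)) = (-1) ^ (i j)` for `∂ y ⊗ x`.
      rw [tensor_diff_tmul, map_add, he _ _ _ _ (C.diff_mem _ _ hx) hy,
        he _ _ _ _ (C.sign_mem hx) (D.diff_mem _ _ hy), he _ _ _ _ hx hy, map_zsmul,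
        tensor_diff_tmul, C.sign_of_mem hx, D.sign_of_mem hy, tmul_zsmul, zsmul_tmul, smul_add,
        smul_smul, smul_smul, ← Units.val_mul, ← Units.val_mul, Prod.fst_sub, Prod.fst_sub,
        sub_mul, mul_sub, one_mul, mul_one, Int.negOnePow_sub, Int.negOnePow_sub,
        mul_assoc, Int.units_mul_self, mul_one, add_comm]
    | add y z hy hz => simp only [map_add, hy, hz]
  · refine tensor_apply_mem e.toLinearMap.toAddMonoidHom _ n (fun i j x y hx hy hij => ?_) hz
    change e (tmul x y) ∈ _
    rw [he _ _ _ _ hx hy]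
    exact AddSubgroup.zsmul_mem _ (tmul_mem hy hx (by rw [add_comm, hij])) _

end SComplex

/-! ## The group of local equivalence classes -/

namespace LocalEquivalenceClass

variable {G : GridData.{u}}

theorem mk_eq_mk_iff {C D : SComplex G} {hC : C.IsKnotlike} {hD : D.IsKnotlike} :
    mk C hC = mk D hD ↔ (∃ f : SComplex.ChainMap C D, f.IsLocal) ∧
      ∃ f : SComplex.ChainMap D C, f.IsLocal :=
  Quotient.eq (r := localEquivalence G)

theorem ind {motive : LocalEquivalenceClass G → Prop} (h : ∀ C hC, motive (mk C hC)) (c) :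
    motive c :=
  Quotient.inductionOn c fun C => h C.1 C.2

/-- The product of local equivalence classes. -/
def mul : LocalEquivalenceClass G → LocalEquivalenceClass G → LocalEquivalenceClass G :=
  Quotient.map₂ (fun C D => ⟨C.1.tensor D.1, C.2.tensor D.2⟩)
    fun C C' ⟨⟨_, hf⟩, ⟨_, hf'⟩⟩ D D' ⟨⟨_, hg⟩, ⟨_, hg'⟩⟩ =>
      ⟨⟨_, hf.tensor C.2 C'.2 D.2 D'.2 hg⟩, ⟨_, hf'.tensor C'.2 C.2 D'.2 D.2 hg'⟩⟩

/-- The inverse of a local equivalence class. -/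
def inv : LocalEquivalenceClass G → LocalEquivalenceClass G :=
  Quotient.map (fun C => ⟨C.1.dual, C.2.dual⟩)
    fun C D ⟨⟨_, hf⟩, ⟨_, hg⟩⟩ => ⟨⟨_, hg.dual D.2 C.2⟩, ⟨_, hf.dual C.2 D.2⟩⟩

/-- The class of the trivial complex. -/
def one : LocalEquivalenceClass G := mk (SComplex.trivial G) (SComplex.isKnotlike_trivial G)

protected theorem mul_comm (a b : LocalEquivalenceClass G) : mul a b = mul b a := by
  induction a using ind with | h C hC
  induction b using ind with | h D hD
  exact mk_eq_mk_iff.2 (C.exists_isLocal_comm D)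

protected theorem mul_assoc (a b c : LocalEquivalenceClass G) :
    mul (mul a b) c = mul a (mul b c) := by
  induction a using ind with | h C hC
  induction b using ind with | h D hD
  induction c using ind with | h E hE
  exact mk_eq_mk_iff.2 (C.exists_isLocal_assoc D E)

protected theorem mul_one (a : LocalEquivalenceClass G) : mul a one = a := by
  induction a using ind with | h C hC
  exact mk_eq_mk_iff.2 C.exists_isLocal_tensor_trivial

protected theorem mul_inv (a : LocalEquivalenceClass G) : mul a (inv a) = one := by
  induction a using ind with | h C hC
  exact mk_eq_mk_iff.2 ⟨⟨_, SComplex.isLocal_eval hC⟩, SComplex.exists_isLocal_coeval hC⟩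

/-- The abelian group of local equivalence classes. -/
abbrev commGroup (G : GridData.{u}) : CommGroup (LocalEquivalenceClass G) where
  mul := mul
  one := one
  inv := inv
  mul_assoc := LocalEquivalenceClass.mul_assoc
  one_mul a := (LocalEquivalenceClass.mul_comm one a).trans a.mul_one
  mul_one := LocalEquivalenceClass.mul_one
  inv_mul_cancel a := (LocalEquivalenceClass.mul_comm (inv a) a).trans a.mul_inv
  mul_comm := LocalEquivalenceClass.mul_comm

end LocalEquivalenceClass

end

/-! ### The proposition -/

theorem mainTheorem2 (G : GridData.{u}) :
    -- the product of two local maps between knotlike complexes is a local map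
    (∀ C C' D D' : SComplex G, C.IsKnotlike → C'.IsKnotlike → D.IsKnotlike → D'.IsKnotlike →
      ∀ (f : SComplex.ChainMap C C') (g : SComplex.ChainMap D D'), f.IsLocal → g.IsLocal →
        ∃ h : SComplex.ChainMap (C.tensor D) (C'.tensor D'),
          h.toLinearMap = TensorProduct.map f.toLinearMap g.toLinearMap ∧ h.IsLocal) ∧
    -- the dual of a local map between knotlike complexes is a local map
    (∀ C D : SComplex G, C.IsKnotlike → D.IsKnotlike →
      ∀ f : SComplex.ChainMap C D, f.IsLocal →
        ∃ h : SComplex.ChainMap D.dual C.dual,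
          h.toLinearMap = f.toLinearMap.dualMap ∧ h.IsLocal) ∧
    -- the local equivalence classes form an abelian group under the tensor product, with the class
    -- of the trivial complex as identity and the classes of the duals as inverses
    ∃ _ : CommGroup (LocalEquivalenceClass G),
      (∀ (C D : SComplex G) (hC : C.IsKnotlike) (hD : D.IsKnotlike),
        ∃ hCD : (C.tensor D).IsKnotlike,
          LocalEquivalenceClass.mk C hC * LocalEquivalenceClass.mk D hD =
            LocalEquivalenceClass.mk (C.tensor D) hCD) ∧
      (∃ hS : (SComplex.trivial G).IsKnotlike,
        1 = LocalEquivalenceClass.mk (SComplex.trivial G) hS) ∧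
      ∀ (C : SComplex G) (hC : C.IsKnotlike),
        ∃ hC' : C.dual.IsKnotlike,
          (LocalEquivalenceClass.mk C hC)⁻¹ = LocalEquivalenceClass.mk C.dual hC' := by
  refine ⟨fun C C' D D' hC hC' hD hD' f g hf hg =>
    ⟨hf.tensorChainMap g, rfl, hf.tensor hC hC' hD hD' hg⟩,
    fun C D hC hD f hf => ⟨hf.dualChainMap, rfl, hf.dual hC hD⟩,
    LocalEquivalenceClass.commGroup G, fun C D hC hD => ⟨hC.tensor hD, rfl⟩,
    ⟨SComplex.isKnotlike_trivial G, rfl⟩, fun C hC => ⟨hC.dual, rfl⟩⟩
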